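/- Let $N\ge 1$ be an integer and let $a,b\in\mathbb R$ satisfy $\left(\frac N2-a\right)^2\ge N+1$. Let $X_{a,b}(\mathbb R^N)$ be the set of (real or complex) vector fields $\mathbf U\in C^\infty(\mathbb R^N\setminus\{0\})^N$ such that $$\int_{\mathbb R^N}\frac{|\nabla \mathbf U|^2}{|x|^{2a}}\,dx<\infty,\qquad \int_{\mathbb R^N}\frac{|\mathbf U|^2}{|x|^{2b}}\,dx<\infty,\qquad \int_{\mathbb R^N}\frac{|\mathbf U|^2}{|x|^{a+b+1}}\,dx<\infty,$$ $$\lim_{|x|\to 0,\infty}|x|^{-1+\frac N2-a}\,\mathbf U(x)=0,\qquad \lim_{|x|\to 0,\infty}|x|^{-b+\frac N2}\,\mathbf U(x)=0,$$ where $|\nabla\mathbf U|^2=\sum_{i,j}|\partial_jU_i|^2$. Below, $u$ denotes a (real- or complex-valued) function that is differentiable on $\mathbb R^N\setminus\{0\}$, and $|D^2u|^2=\sum_{i,j}|\partial_j\partial_i u|^2$. (1) If $a-b+1>0$, then for every $u$ with $\nabla u\in X_{a,b}(\mathbb R^N)$ $$\int_{\mathbb R^N}\frac{|D^2u|^2}{|x|^{2a}}\,dx\int_{\mathbb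 R^N}\frac{|\nabla u|^2}{|x|^{2b}}\,dx\ \ge\ C^2(N,a,b)\left(\int_{\mathbb R^N}\frac{|\nabla u|^2}{|x|^{a+b+1}}\,dx\right)^2,\qquad (*)$$ where $$C(N,a,b)=\sqrt{\left(1-\tfrac N2+a\right)^2+N-1}+\frac{a-b+1}2 .$$ The constant $C^2(N,a,b)$ is sharp, that is, it is the largest constant for which $(*)$ holds for all $u$ with $\nabla u\in X_{a,b}(\mathbb R^N)$. It is attained: for all $\gamma\in\mathbb R$ and $\beta>0$ there are functions $u$ such that, for $x\ne0$, $$\nabla u(x)=\gamma\,|x|^{-\frac N2+a+\sqrt{\left(1-\frac N2+a\right)^2+N-1}}\;e^{-\frac{\beta}{a-b+1}|x|^{a-b+1}}\,x,$$ and every such $u$ satisfies $\nabla u\in X_{a,b}(\mathbb R^N)$ and equality in $(*)$. (2) If $a-b+1<0$, then $(*)$ holds for every $u$ with $\nabla u\in X_{a,b}(\mathbb R^N)$, with $$C(N,a,b)=\sqrt{\left(1-\tfrac N2+a\right)^2+N-1}-\frac{a-b+1}2 .$$ The constant $C^2(N,a,b)$ is again sharp in the same sense. It is attained: for all $\gamma\in\mathbb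 R$ and $\beta<0$ there are functions $u$ such that, for $x\ne0$, $$\nabla u(x)=\gamma\,|x|^{-\frac N2+a-\sqrt{\left(1-\frac N2+a\right)^2+N-1}}\;e^{-\frac{\beta}{a-b+1}|x|^{a-b+1}}\,x,$$ and every such $u$ satisfies $\nabla u\in X_{a,b}(\mathbb R^N)$ and equality in $(*)$. -/

import Mathlib

open MeasureTheory Filter Topology
open scoped ContDiff

noncomputable section

namespace CKN

variable {𝕜 : Type*} [RCLike 𝕜] {N : ℕ}

/-- The `i`-th partial derivative of a real- or complex-valued function on `ℝ^N`. -/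
def partialDeriv (i : Fin N) (f : EuclideanSpace ℝ (Fin N) → 𝕜) :
    EuclideanSpace ℝ (Fin N) → 𝕜 :=
  fun x => fderiv ℝ f x (EuclideanSpace.single i (1 : ℝ))

/-- The gradient `∇u = (∂₁u, …, ∂_N u)`, a vector field with values in `𝕜^N`. -/
def grad (u : EuclideanSpace ℝ (Fin N) → 𝕜) :
    EuclideanSpace ℝ (Fin N) → EuclideanSpace 𝕜 (Fin N) :=
  fun x => WithLp.toLp 2 (fun i => partialDeriv i u x)

/-- `|∇U|² = ∑ᵢ ∑ⱼ |∂ⱼ Uᵢ|²` for a vector field `U`. -/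
def jacobianNormSq (U : EuclideanSpace ℝ (Fin N) → EuclideanSpace 𝕜 (Fin N))
    (x : EuclideanSpace ℝ (Fin N)) : ℝ :=
  ∑ i, ∑ j, ‖partialDeriv j (fun y => U y i) x‖ ^ 2

/-- `|D²u|² = ∑ᵢ ∑ⱼ |∂ⱼ ∂ᵢ u|²` for a scalar function `u`. -/
def hessianNormSq (u : EuclideanSpace ℝ (Fin N) → 𝕜)
    (x : EuclideanSpace ℝ (Fin N)) : ℝ :=
  ∑ i, ∑ j, ‖partialDeriv j (partialDeriv i u) x‖ ^ 2

/-- The class `X_{a,b}(ℝ^N)` of vector fields, smooth off the origin, with finite weighted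
integrals and with the prescribed decay at the origin and at infinity. The value at the origin
is irrelevant. -/
structure MemX (a b : ℝ) (U : EuclideanSpace ℝ (Fin N) → EuclideanSpace 𝕜 (Fin N)) : Prop where
  smooth : ContDiffOn ℝ ∞ U {0}ᶜ
  integrable_jacobian : Integrable (fun x => jacobianNormSq U x / ‖x‖ ^ (2 * a)) volume
  integrable_field : Integrable (fun x => ‖U x‖ ^ 2 / ‖x‖ ^ (2 * b)) volume
  integrable_mixed : Integrable (fun x => ‖U x‖ ^ 2 / ‖x‖ ^ (a + b + 1)) volume
  tendsto_zero_a : Tendsto (fun x => ‖x‖ ^ (-1 + (N : ℝ) / 2 - a) * ‖U x‖) (𝓝[≠] 0) (𝓝 0)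
  tendsto_infty_a : Tendsto (fun x => ‖x‖ ^ (-1 + (N : ℝ) / 2 - a) * ‖U x‖)
    (Bornology.cobounded (EuclideanSpace ℝ (Fin N))) (𝓝 0)
  tendsto_zero_b : Tendsto (fun x => ‖x‖ ^ (-b + (N : ℝ) / 2) * ‖U x‖) (𝓝[≠] 0) (𝓝 0)
  tendsto_infty_b : Tendsto (fun x => ‖x‖ ^ (-b + (N : ℝ) / 2) * ‖U x‖)
    (Bornology.cobounded (EuclideanSpace ℝ (Fin N))) (𝓝 0)

/-- `u` is a scalar potential, differentiable off the origin, whose gradient lies in `X_{a,b}`. -/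
def IsAdmissible (a b : ℝ) (u : EuclideanSpace ℝ (Fin N) → 𝕜) : Prop :=
  DifferentiableOn ℝ u {0}ᶜ ∧ MemX a b (grad u)

/-- `∫ |D²u|² |x|^{-p} dx`. -/
def hessianEnergy (p : ℝ) (u : EuclideanSpace ℝ (Fin N) → 𝕜) : ℝ :=
  ∫ x, hessianNormSq u x / ‖x‖ ^ p

/-- `∫ |∇u|² |x|^{-p} dx`. -/
def gradEnergy (p : ℝ) (u : EuclideanSpace ℝ (Fin N) → 𝕜) : ℝ :=
  ∫ x, ‖grad u x‖ ^ 2 / ‖x‖ ^ p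

/-- The radial vector field `γ |x|^κ exp(-(β/s) |x|^s) x`. -/
def radialField (𝕜 : Type*) [RCLike 𝕜] (κ s γ β : ℝ) (x : EuclideanSpace ℝ (Fin N)) :
    EuclideanSpace 𝕜 (Fin N) :=
  WithLp.toLp 2 (fun i =>
    ((γ * ‖x‖ ^ κ * Real.exp (-(β / s) * ‖x‖ ^ s) * x i : ℝ) : 𝕜))

end CKN

end

/-!
Write `m = 1 - N / 2 + a`, `s = a - b + 1`, and let `σ` be the square root of `m² + N - 1`, with the
sign of `s`. With `A = ∫ |D²u|² |x|^(-2a)`, `B = ∫ |∇u|² |x|^(-2b)` and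
`D = ∫ |∇u|² |x|^(-a-b-1)`, the claim `A B ≥ (σ + s / 2)² D²` is the discriminant condition for
`A + t² B ≥ t (2 σ + s) D` for all real `t` (`IsAdmissible.quadratic`).

To prove the quadratic inequality, split `|x|² |D²u|²` into the squares of the radial derivative
`r∂_r U` of `U = ∇u` and of its spherical gradient. If the angular part contributes at least
`(N - 1) |U|²`, completing the square `|r∂_r U - (m + σ) U + t r^s U|² ≥ 0` and integrating by
parts in the radial variable gives the result (`RadialCutoff.radial_square`); the equation
`σ² = m² + N - 1` is what makes the terms in `|U|² r^(-2a-2)` cancel.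

A field whose spherical means do not vanish need not satisfy that angular bound. For a gradient
field it holds after integration when `(N / 2 - a)² ≥ N + 1` (`RadialCutoff.angular_hardy`). The
angular energy of `∇u`, minus `(N - 1) |∇u|²`, is expressed through the spherical Hessian `H` and the
spherical gradient `T` of `u` (`angular_energy_eq`). Then `∫ |H|² ≥ ∫ |T|²` on each sphere, which is
the Bochner identity for `N ≥ 3` and Wirtinger's inequality for `N = 2`
(`RadialCutoff.wInt_grad_le_hess`), and a radial Hardy inequality for `r∂_r T` yields exactly the
multiple `(N / 2 - a)² - (N + 1)` of `∫ |T|²`.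

All integrations by parts are done against a smooth radial cutoff supported in an annulus, so that
the boundary terms are integrals over two dilated shells; the decay conditions at the origin and at
infinity make them vanish in the limit (`tendsto_boundary`).

For the extremal fields all three energies are integrals `∫ |x|^(q-N) exp(-c |x|^s)`, which are Gamma
integrals; the functional equation of the Gamma function (`radialInt_add`) gives `A = β² B` and
`(σ + s / 2) D = β B`, hence equality, and `D > 0` gives sharpness. Using the signed root `σ`, both
signs of `s` are instances of `sharp_inequality`.
-/

namespace CKN

variable {N : ℕ}

/-! ### Radial and spherical derivatives -/

/-- Smoothness on the complement of the origin. -/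
@[fun_prop]
def SmoothOff (f : EuclideanSpace ℝ (Fin N) → ℝ) : Prop :=
  ContDiffOn ℝ ∞ f {0}ᶜ

/-- Derivative of `f` along the vector field `V`. -/
noncomputable def fieldDeriv (V : EuclideanSpace ℝ (Fin N) → EuclideanSpace ℝ (Fin N))
    (f : EuclideanSpace ℝ (Fin N) → ℝ) (x : EuclideanSpace ℝ (Fin N)) : ℝ :=
  fderiv ℝ f x (V x)

/-- The field `‖x‖ e_j - (x_j / ‖x‖) x`: the `j`-th basis vector projected to the sphere through
`x` and scaled by `‖x‖`, so that it is homogeneous of degree one. -/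
noncomputable def angField (j : Fin N) (x : EuclideanSpace ℝ (Fin N)) :
    EuclideanSpace ℝ (Fin N) :=
  ‖x‖ • EuclideanSpace.single j (1 : ℝ) - (x j / ‖x‖) • x

/-- The Euler field `x`. -/
def radField (x : EuclideanSpace ℝ (Fin N)) : EuclideanSpace ℝ (Fin N) := x

/-- The Euler derivative `x · ∇ = r ∂_r`. -/
notation "radDeriv" => fieldDeriv radField

/-- The `j`-th component of the spherical gradient, `r ∂_j - (x_j / r) x · ∇`. -/
notation:max "angDeriv" j:max => fieldDeriv (angField j)

/-- The `j`-th coordinate of the unit vector `x / ‖x‖`. -/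
noncomputable def dir (j : Fin N) (x : EuclideanSpace ℝ (Fin N)) : ℝ := x j / ‖x‖

/-! ### Calculus of functions smooth off the origin -/

lemma smoothOff_iff {f : EuclideanSpace ℝ (Fin N) → ℝ} :
    SmoothOff f ↔ ∀ x, x ≠ 0 → ContDiffAt ℝ ∞ f x :=
  ⟨fun h _ hx => h.contDiffAt (isOpen_compl_singleton.mem_nhds hx),
    fun h x hx => (h x hx).contDiffWithinAt⟩

lemma SmoothOff.contDiffAt {f : EuclideanSpace ℝ (Fin N) → ℝ} (h : SmoothOff f)
    {x : EuclideanSpace ℝ (Fin N)} (hx : x ≠ 0) : ContDiffAt ℝ ∞ f x :=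
  smoothOff_iff.1 h x hx

lemma SmoothOff.differentiableAt {f : EuclideanSpace ℝ (Fin N) → ℝ} (h : SmoothOff f)
    {x : EuclideanSpace ℝ (Fin N)} (hx : x ≠ 0) : DifferentiableAt ℝ f x :=
  (h.contDiffAt hx).differentiableAt (by simp)

@[fun_prop]
lemma SmoothOff.add {f g : EuclideanSpace ℝ (Fin N) → ℝ} (hf : SmoothOff f) (hg : SmoothOff g) :
    SmoothOff (fun x => f x + g x) := ContDiffOn.add hf hg

@[fun_prop]
lemma SmoothOff.sub {f g : EuclideanSpace ℝ (Fin N) → ℝ} (hf : SmoothOff f) (hg : SmoothOff g) :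
    SmoothOff (fun x => f x - g x) := ContDiffOn.sub hf hg

@[fun_prop]
lemma SmoothOff.mul {f g : EuclideanSpace ℝ (Fin N) → ℝ} (hf : SmoothOff f) (hg : SmoothOff g) :
    SmoothOff (fun x => f x * g x) := ContDiffOn.mul hf hg

@[fun_prop]
lemma SmoothOff.pow {f : EuclideanSpace ℝ (Fin N) → ℝ} (hf : SmoothOff f) (n : ℕ) :
    SmoothOff (fun x => f x ^ n) := ContDiffOn.pow hf n

@[fun_prop]
lemma SmoothOff.const (c : ℝ) : SmoothOff (fun _ : EuclideanSpace ℝ (Fin N) => c) :=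
  contDiffOn_const

@[fun_prop]
lemma SmoothOff.sum {ι : Type*} {s : Finset ι} {f : ι → EuclideanSpace ℝ (Fin N) → ℝ}
    (hf : ∀ i ∈ s, SmoothOff (f i)) : SmoothOff (fun x => ∑ i ∈ s, f i x) :=
  ContDiffOn.sum hf

@[fun_prop]
lemma SmoothOff.coord (j : Fin N) : SmoothOff (fun x : EuclideanSpace ℝ (Fin N) => x j) :=
  (EuclideanSpace.proj (𝕜 := ℝ) j).contDiff.contDiffOn

@[fun_prop]
lemma SmoothOff.norm_rpow (p : ℝ) : SmoothOff (fun x : EuclideanSpace ℝ (Fin N) => ‖x‖ ^ p) :=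
  smoothOff_iff.2 fun _ hx =>
    (contDiffAt_norm ℝ hx).rpow_const_of_ne (norm_ne_zero_iff.2 hx)

@[fun_prop]
lemma SmoothOff.norm : SmoothOff (fun x : EuclideanSpace ℝ (Fin N) => ‖x‖) :=
  smoothOff_iff.2 fun _ hx => contDiffAt_norm ℝ hx

@[fun_prop]
lemma SmoothOff.dir (j : Fin N) : SmoothOff (dir j) :=
  smoothOff_iff.2 fun _ hx => ((SmoothOff.coord j).contDiffAt hx).div
    (contDiffAt_norm ℝ hx) (norm_ne_zero_iff.2 hx)

lemma contDiffAt_angField (j : Fin N) {x : EuclideanSpace ℝ (Fin N)} (hx : x ≠ 0) :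
    ContDiffAt ℝ ∞ (angField j) x :=
  ((contDiffAt_norm ℝ hx).smul contDiffAt_const).sub
    (((SmoothOff.dir j).contDiffAt hx).smul contDiffAt_id)

lemma SmoothOff.along {V : EuclideanSpace ℝ (Fin N) → EuclideanSpace ℝ (Fin N)}
    (hV : ∀ x, x ≠ 0 → ContDiffAt ℝ ∞ V x) {f : EuclideanSpace ℝ (Fin N) → ℝ}
    (hf : SmoothOff f) : SmoothOff (fieldDeriv V f) :=
  smoothOff_iff.2 fun x hx =>
    ((hf.contDiffAt hx).fderiv_right (m := ∞) (by simp)).clm_apply (hV x hx)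

@[fun_prop]
lemma SmoothOff.ang {f : EuclideanSpace ℝ (Fin N) → ℝ} (hf : SmoothOff f) (j : Fin N) :
    SmoothOff (angDeriv j f) :=
  hf.along fun _ hx => contDiffAt_angField j hx

@[fun_prop]
lemma SmoothOff.rad {f : EuclideanSpace ℝ (Fin N) → ℝ} (hf : SmoothOff f) :
    SmoothOff (radDeriv f) :=
  hf.along fun _ _ => contDiffAt_id

lemma fieldDeriv_congr {V : EuclideanSpace ℝ (Fin N) → EuclideanSpace ℝ (Fin N)}
    {f g : EuclideanSpace ℝ (Fin N) → ℝ} (h : ∀ x, x ≠ 0 → f x = g x)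
    {x : EuclideanSpace ℝ (Fin N)} (hx : x ≠ 0) : fieldDeriv V f x = fieldDeriv V g x := by
  have : f =ᶠ[𝓝 x] g := by
    filter_upwards [isOpen_compl_singleton.mem_nhds hx] with y hy using h y hy
  simp only [fieldDeriv, this.fderiv_eq]

lemma fieldDeriv_mul {V : EuclideanSpace ℝ (Fin N) → EuclideanSpace ℝ (Fin N)}
    {f g : EuclideanSpace ℝ (Fin N) → ℝ} (hf : SmoothOff f) (hg : SmoothOff g)
    {x : EuclideanSpace ℝ (Fin N)} (hx : x ≠ 0) :
    fieldDeriv V (fun y => f y * g y) x = fieldDeriv V f x * g x + f x * fieldDeriv V g x := by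
  simp only [fieldDeriv]
  rw [fderiv_fun_mul (hf.differentiableAt hx) (hg.differentiableAt hx)]
  simp; ring

lemma fieldDeriv_add {V : EuclideanSpace ℝ (Fin N) → EuclideanSpace ℝ (Fin N)}
    {f g : EuclideanSpace ℝ (Fin N) → ℝ} (hf : SmoothOff f) (hg : SmoothOff g)
    {x : EuclideanSpace ℝ (Fin N)} (hx : x ≠ 0) :
    fieldDeriv V (fun y => f y + g y) x = fieldDeriv V f x + fieldDeriv V g x := by
  simp only [fieldDeriv]
  rw [fderiv_fun_add (hf.differentiableAt hx) (hg.differentiableAt hx)]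
  simp

lemma fieldDeriv_sum {V : EuclideanSpace ℝ (Fin N) → EuclideanSpace ℝ (Fin N)}
    {ι : Type*} {s : Finset ι}
    {f : ι → EuclideanSpace ℝ (Fin N) → ℝ} (hf : ∀ i ∈ s, SmoothOff (f i))
    {x : EuclideanSpace ℝ (Fin N)} (hx : x ≠ 0) :
    fieldDeriv V (fun y => ∑ i ∈ s, f i y) x = ∑ i ∈ s, fieldDeriv V (f i) x := by
  simp only [fieldDeriv]
  rw [fderiv_fun_sum fun i hi => (hf i hi).differentiableAt hx]
  simp

lemma fieldDeriv_const {V : EuclideanSpace ℝ (Fin N) → EuclideanSpace ℝ (Fin N)} (c : ℝ)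
    (x : EuclideanSpace ℝ (Fin N)) : fieldDeriv V (fun _ => c) x = 0 := by
  simp [fieldDeriv]

lemma sum_dir_sq {x : EuclideanSpace ℝ (Fin N)} (hx : x ≠ 0) : ∑ i, dir i x ^ 2 = 1 := by
  have h := EuclideanSpace.norm_sq_eq x
  simp only [Real.norm_eq_abs, sq_abs] at h
  simp only [dir, div_pow, ← Finset.sum_div, ← h]
  exact div_self (by positivity)

lemma norm_mul_dir (j : Fin N) {x : EuclideanSpace ℝ (Fin N)} (hx : x ≠ 0) :
    ‖x‖ * dir j x = x j := by
  have := norm_ne_zero_iff.2 hx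
  simp only [dir]; field_simp

lemma fieldDeriv_angField (j : Fin N) (f : EuclideanSpace ℝ (Fin N) → ℝ)
    (x : EuclideanSpace ℝ (Fin N)) :
    angDeriv j f x = ‖x‖ * partialDeriv j f x - dir j x * radDeriv f x := by
  simp [fieldDeriv, angField, partialDeriv, dir, radField]

lemma radDeriv_eq_sum (f : EuclideanSpace ℝ (Fin N) → ℝ) (x : EuclideanSpace ℝ (Fin N)) :
    radDeriv f x = ∑ j, x j * partialDeriv j f x := by
  have h : x = ∑ j, x j • EuclideanSpace.single j (1 : ℝ) := by
    ext i; simp [Pi.single_apply]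
  have h2 : fderiv ℝ f x x = fderiv ℝ f x (∑ j, x j • EuclideanSpace.single j (1 : ℝ)) :=
    congrArg _ h
  simpa [fieldDeriv, partialDeriv, radField] using h2

lemma sum_dir_mul_partialDeriv (f : EuclideanSpace ℝ (Fin N) → ℝ)
    {x : EuclideanSpace ℝ (Fin N)} (hx : x ≠ 0) :
    ∑ j, dir j x * (‖x‖ * partialDeriv j f x) = radDeriv f x := by
  rw [radDeriv_eq_sum]
  refine Finset.sum_congr rfl fun j _ => ?_
  rw [← norm_mul_dir j hx]; ring

lemma sum_dir_mul_angDeriv (f : EuclideanSpace ℝ (Fin N) → ℝ)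
    {x : EuclideanSpace ℝ (Fin N)} (hx : x ≠ 0) : ∑ j, dir j x * angDeriv j f x = 0 := by
  simp only [fieldDeriv_angField, mul_sub, Finset.sum_sub_distrib,
    sum_dir_mul_partialDeriv f hx]
  simp only [← mul_assoc, ← sq, ← Finset.sum_mul, sum_dir_sq hx]
  ring

/-- The Euclidean gradient splits orthogonally into its spherical and its radial part. -/
lemma sum_partialDeriv_sq (f : EuclideanSpace ℝ (Fin N) → ℝ)
    {x : EuclideanSpace ℝ (Fin N)} (hx : x ≠ 0) :
    ‖x‖ ^ 2 * ∑ j, partialDeriv j f x ^ 2 = ∑ j, angDeriv j f x ^ 2 + radDeriv f x ^ 2 := by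
  have h : ∀ j, angDeriv j f x ^ 2 = ‖x‖ ^ 2 * partialDeriv j f x ^ 2
      - 2 * radDeriv f x * (dir j x * (‖x‖ * partialDeriv j f x))
      + radDeriv f x ^ 2 * dir j x ^ 2 := fun j => by
    rw [fieldDeriv_angField]; ring
  simp only [h, Finset.sum_add_distrib, Finset.sum_sub_distrib, ← Finset.mul_sum, sum_dir_sq hx,
    sum_dir_mul_partialDeriv f hx]
  ring

lemma partialDeriv_norm (j : Fin N) {x : EuclideanSpace ℝ (Fin N)} (hx : x ≠ 0) :
    partialDeriv j (fun y : EuclideanSpace ℝ (Fin N) => ‖y‖) x = dir j x := by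
  have h : HasFDerivAt (fun y : EuclideanSpace ℝ (Fin N) => ‖y‖) _ x :=
    ((hasStrictFDerivAt_norm_sq x).hasFDerivAt.sqrt (by simpa using hx)).congr_of_eventuallyEq
      (Eventually.of_forall fun y => (Real.sqrt_sq (norm_nonneg y)).symm)
  simp only [partialDeriv, h.fderiv, dir]
  simp [EuclideanSpace.inner_single_right]
  field_simp

lemma partialDeriv_coord (j i : Fin N) (x : EuclideanSpace ℝ (Fin N)) :
    partialDeriv j (fun y : EuclideanSpace ℝ (Fin N) => y i) x = if i = j then 1 else 0 := by
  have h : fderiv ℝ (fun y : EuclideanSpace ℝ (Fin N) => y i) x = EuclideanSpace.proj i :=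
    (EuclideanSpace.proj (𝕜 := ℝ) i).hasFDerivAt.fderiv
  simp [partialDeriv, h]

lemma radDeriv_norm {x : EuclideanSpace ℝ (Fin N)} (hx : x ≠ 0) :
    radDeriv (fun y : EuclideanSpace ℝ (Fin N) => ‖y‖) x = ‖x‖ := by
  rw [← sum_dir_mul_partialDeriv _ hx]
  simp only [partialDeriv_norm _ hx]
  calc ∑ j, dir j x * (‖x‖ * dir j x) = ‖x‖ * ∑ j, dir j x ^ 2 := by
        rw [Finset.mul_sum]; exact Finset.sum_congr rfl fun j _ => by ring
    _ = ‖x‖ := by rw [sum_dir_sq hx, mul_one]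

lemma angDeriv_norm (j : Fin N) {x : EuclideanSpace ℝ (Fin N)} (hx : x ≠ 0) :
    angDeriv j (fun y : EuclideanSpace ℝ (Fin N) => ‖y‖) x = 0 := by
  rw [fieldDeriv_angField, partialDeriv_norm _ hx, radDeriv_norm hx]; ring

lemma fieldDeriv_norm_rpow {V : EuclideanSpace ℝ (Fin N) → EuclideanSpace ℝ (Fin N)} (p : ℝ)
    {x : EuclideanSpace ℝ (Fin N)} (hx : x ≠ 0) :
    fieldDeriv V (fun y : EuclideanSpace ℝ (Fin N) => ‖y‖ ^ p) x =
      p * ‖x‖ ^ (p - 1) * fieldDeriv V (fun y => ‖y‖) x := by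
  have h : HasFDerivAt (fun y : EuclideanSpace ℝ (Fin N) => ‖y‖ ^ p) _ x :=
    (SmoothOff.norm.differentiableAt hx).hasFDerivAt.rpow_const (p := p)
      (Or.inl (norm_ne_zero_iff.2 hx))
  simp only [fieldDeriv, h.fderiv]
  simp

lemma radDeriv_norm_rpow (p : ℝ) {x : EuclideanSpace ℝ (Fin N)} (hx : x ≠ 0) :
    radDeriv (fun y : EuclideanSpace ℝ (Fin N) => ‖y‖ ^ p) x = p * ‖x‖ ^ p := by
  have h := norm_pos_iff.2 hx
  rw [fieldDeriv_norm_rpow p hx, radDeriv_norm hx, mul_assoc, ← Real.rpow_add_one h.ne']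
  simp

lemma angDeriv_norm_rpow (j : Fin N) (p : ℝ) {x : EuclideanSpace ℝ (Fin N)} (hx : x ≠ 0) :
    angDeriv j (fun y : EuclideanSpace ℝ (Fin N) => ‖y‖ ^ p) x = 0 := by
  rw [fieldDeriv_norm_rpow p hx, angDeriv_norm j hx, mul_zero]

lemma fieldDeriv_dir {V : EuclideanSpace ℝ (Fin N) → EuclideanSpace ℝ (Fin N)} (i : Fin N)
    {x : EuclideanSpace ℝ (Fin N)} (hx : x ≠ 0) :
    ‖x‖ * fieldDeriv V (dir i) x = V x i - dir i x * fieldDeriv V (fun y => ‖y‖) x := by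
  have h : fieldDeriv V (fun y : EuclideanSpace ℝ (Fin N) => ‖y‖ * dir i y) x = V x i := by
    rw [fieldDeriv_congr (g := fun y => y i) (fun y hy => norm_mul_dir i hy) hx]
    have h : fderiv ℝ (fun y : EuclideanSpace ℝ (Fin N) => y i) x = EuclideanSpace.proj i :=
      (EuclideanSpace.proj (𝕜 := ℝ) i).hasFDerivAt.fderiv
    simp [fieldDeriv, h]
  rw [fieldDeriv_mul SmoothOff.norm (SmoothOff.dir i) hx] at h
  linear_combination h

lemma radDeriv_dir (i : Fin N) {x : EuclideanSpace ℝ (Fin N)} (hx : x ≠ 0) :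
    radDeriv (dir i) x = 0 := by
  have h := fieldDeriv_dir (V := radField) i hx
  have h' := norm_mul_dir i hx
  rw [radDeriv_norm hx, radField] at h
  have : ‖x‖ * radDeriv (dir i) x = 0 := by linear_combination h - h'
  exact (mul_eq_zero.1 this).resolve_left (norm_ne_zero_iff.2 hx)

lemma angDeriv_dir (j i : Fin N) {x : EuclideanSpace ℝ (Fin N)} (hx : x ≠ 0) :
    angDeriv j (dir i) x = (if i = j then 1 else 0) - dir i x * dir j x := by
  have h := fieldDeriv_dir (V := angField j) i hx
  have h' := norm_mul_dir i hx
  rw [angDeriv_norm j hx] at h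
  have h2 : angField j x i = ‖x‖ * ((if i = j then 1 else 0) - dir i x * dir j x) := by
    simp only [angField, PiLp.sub_apply, PiLp.smul_apply, PiLp.single_apply,
      smul_eq_mul, mul_sub]
    rw [← mul_assoc, h', dir]; ring
  rw [h2] at h
  exact mul_left_cancel₀ (norm_ne_zero_iff.2 hx) (by linear_combination h)

/-- Second derivatives along two vector fields, expanded through the second Fréchet derivative. -/
lemma fieldDeriv_fieldDeriv {V W : EuclideanSpace ℝ (Fin N) → EuclideanSpace ℝ (Fin N)}
    {f : EuclideanSpace ℝ (Fin N) → ℝ} (hf : SmoothOff f)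
    {x : EuclideanSpace ℝ (Fin N)} (hx : x ≠ 0) (hV : ContDiffAt ℝ ∞ V x) :
    fieldDeriv W (fieldDeriv V f) x =
      fderiv ℝ (fderiv ℝ f) x (W x) (V x) + fderiv ℝ f x (fderiv ℝ V x (W x)) := by
  have h1 : DifferentiableAt ℝ (fderiv ℝ f) x :=
    ((hf.contDiffAt hx).fderiv_right (m := ∞) (by simp)).differentiableAt (by simp)
  have h2 : DifferentiableAt ℝ V x := hV.differentiableAt (by simp)
  have h3 : HasFDerivAt (fieldDeriv V f) _ x := h1.hasFDerivAt.clm_apply h2.hasFDerivAt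
  rw [fieldDeriv, h3.fderiv]
  simp [add_comm]

lemma fieldDeriv_comm {V W : EuclideanSpace ℝ (Fin N) → EuclideanSpace ℝ (Fin N)}
    {f : EuclideanSpace ℝ (Fin N) → ℝ} (hf : SmoothOff f)
    {x : EuclideanSpace ℝ (Fin N)} (hx : x ≠ 0) (hV : ContDiffAt ℝ ∞ V x)
    (hW : ContDiffAt ℝ ∞ W x) :
    fieldDeriv W (fieldDeriv V f) x - fieldDeriv V (fieldDeriv W f) x =
      fderiv ℝ f x (fderiv ℝ V x (W x) - fderiv ℝ W x (V x)) := by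
  have hs : IsSymmSndFDerivAt ℝ f x :=
    (hf.contDiffAt hx).isSymmSndFDerivAt
      (by simpa using (mod_cast le_top : ((2 : ℕ∞) : WithTop ℕ∞) ≤ ∞))
  rw [fieldDeriv_fieldDeriv hf hx hV, fieldDeriv_fieldDeriv hf hx hW, hs.eq, map_sub]
  ring

lemma fderiv_angField (j : Fin N) {x : EuclideanSpace ℝ (Fin N)} (hx : x ≠ 0)
    (v : EuclideanSpace ℝ (Fin N)) :
    fderiv ℝ (angField j) x v = fderiv ℝ (fun y => ‖y‖) x v • EuclideanSpace.single j (1 : ℝ) -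
      (fderiv ℝ (dir j) x v • x + dir j x • v) := by
  have h1 := (SmoothOff.norm.differentiableAt hx).hasFDerivAt
  have h2 := ((SmoothOff.dir j).differentiableAt hx).hasFDerivAt
  have h3 : HasFDerivAt (angField j) _ x :=
    (h1.smul_const (EuclideanSpace.single j (1 : ℝ))).sub (h2.smul (hasFDerivAt_id x))
  rw [h3.fderiv]
  simp [add_comm]

/-- The radial and the spherical derivatives commute, since the spherical fields are homogeneous
of degree one. -/
lemma angDeriv_radDeriv (j : Fin N) {f : EuclideanSpace ℝ (Fin N) → ℝ} (hf : SmoothOff f)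
    {x : EuclideanSpace ℝ (Fin N)} (hx : x ≠ 0) :
    angDeriv j (radDeriv f) x = radDeriv (angDeriv j f) x := by
  rw [← sub_eq_zero, fieldDeriv_comm hf hx (V := radField) contDiffAt_id (contDiffAt_angField j hx),
    fderiv_angField j hx]
  have h1 := radDeriv_norm hx
  have h2 := radDeriv_dir j hx
  have h3 : fderiv ℝ (radField (N := N)) x = ContinuousLinearMap.id ℝ _ := fderiv_id
  simp only [fieldDeriv] at h1 h2
  rw [h1, h2, h3]
  simp [angField, dir, radField]

/-- The spherical fields do not commute; their bracket produces the curvature term of the sphere. -/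
lemma angDeriv_comm (i k : Fin N) {f : EuclideanSpace ℝ (Fin N) → ℝ} (hf : SmoothOff f)
    {x : EuclideanSpace ℝ (Fin N)} (hx : x ≠ 0) :
    angDeriv i (angDeriv k f) x =
      angDeriv k (angDeriv i f) x + (dir i x * angDeriv k f x - dir k x * angDeriv i f x) := by
  rw [← sub_eq_iff_eq_add', fieldDeriv_comm hf hx (contDiffAt_angField k hx)
    (contDiffAt_angField i hx), fderiv_angField _ hx, fderiv_angField _ hx]
  have h1 := angDeriv_norm i hx
  have h2 := angDeriv_norm k hx
  have h3 := angDeriv_dir i k hx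
  have h4 := angDeriv_dir k i hx
  simp only [fieldDeriv] at h1 h2 h3 h4 ⊢
  rw [h1, h2, h3, h4]
  simp only [zero_smul, zero_sub, map_sub, map_neg, map_add, map_smul, smul_eq_mul, eq_comm (a := k)]
  ring

end CKN

namespace CKN

variable {N : ℕ}

/-! ### Integration by parts against radial cutoffs -/

/-- Functions that are smooth and supported in an annulus `ρ ≤ ‖x‖ ≤ R` with `0 < ρ`. -/
structure Annular (w : EuclideanSpace ℝ (Fin N) → ℝ) : Prop where
  smooth : SmoothOff w
  supp : ∃ ρ R : ℝ, 0 < ρ ∧ ∀ x, w x ≠ 0 → ρ ≤ ‖x‖ ∧ ‖x‖ ≤ R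

/-- Annular functions whose spherical gradient vanishes. -/
structure RadialCutoff (w : EuclideanSpace ℝ (Fin N) → ℝ) : Prop extends Annular w where
  ang : ∀ j x, x ≠ 0 → angDeriv j w x = 0

lemma Annular.zero {w : EuclideanSpace ℝ (Fin N) → ℝ} (hw : Annular w) : w 0 = 0 := by
  obtain ⟨ρ, R, hρ, h⟩ := hw.supp
  by_contra h0
  have := (h 0 h0).1
  simp at this
  linarith

lemma Annular.eventually_zero {w : EuclideanSpace ℝ (Fin N) → ℝ} (hw : Annular w) :
    ∀ᶠ x in 𝓝 0, w x = 0 := by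
  obtain ⟨ρ, R, hρ, h⟩ := hw.supp
  filter_upwards [Metric.ball_mem_nhds 0 hρ] with x hx
  by_contra h0
  have := (h x h0).1
  simp at hx
  linarith

lemma Annular.contDiff {w : EuclideanSpace ℝ (Fin N) → ℝ} (hw : Annular w) : ContDiff ℝ ∞ w := by
  rw [contDiff_iff_contDiffAt]
  intro x
  by_cases hx : x = 0
  · subst hx
    exact (contDiffAt_const (c := 0)).congr_of_eventuallyEq hw.eventually_zero
  · exact hw.smooth.contDiffAt hx

lemma Annular.hasCompactSupport {w : EuclideanSpace ℝ (Fin N) → ℝ} (hw : Annular w) :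
    HasCompactSupport w := by
  obtain ⟨ρ, R, hρ, h⟩ := hw.supp
  refine HasCompactSupport.intro (isCompact_closedBall 0 R) fun x hx => ?_
  by_contra h0
  exact hx (by simpa using (h x h0).2)

lemma Annular.integrable {w : EuclideanSpace ℝ (Fin N) → ℝ} (hw : Annular w) :
    Integrable w :=
  hw.contDiff.continuous.integrable_of_hasCompactSupport hw.hasCompactSupport

lemma Annular.mul {w f : EuclideanSpace ℝ (Fin N) → ℝ} (hw : Annular w) (hf : SmoothOff f) :
    Annular (fun x => w x * f x) := by
  obtain ⟨ρ, R, hρ, h⟩ := hw.supp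
  exact ⟨hw.smooth.mul hf, ρ, R, hρ, fun x hx => h x (left_ne_zero_of_mul hx)⟩

lemma Annular.along {V : EuclideanSpace ℝ (Fin N) → EuclideanSpace ℝ (Fin N)}
    (hV : ∀ x, x ≠ 0 → ContDiffAt ℝ ∞ V x) {w : EuclideanSpace ℝ (Fin N) → ℝ} (hw : Annular w) :
    Annular (fieldDeriv V w) := by
  obtain ⟨ρ, R, hρ, h⟩ := hw.supp
  refine ⟨hw.smooth.along hV, ρ, R, hρ, fun x hx => ?_⟩
  have hc : IsClosed {y : EuclideanSpace ℝ (Fin N) | ρ ≤ ‖y‖ ∧ ‖y‖ ≤ R} :=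
    (isClosed_le continuous_const continuous_norm).inter
      (isClosed_le continuous_norm continuous_const)
  by_contra hxs
  apply hx
  have : w =ᶠ[𝓝 x] fun _ => 0 := by
    filter_upwards [hc.isOpen_compl.mem_nhds hxs] with y hy
    by_contra h0
    exact hy (h y h0)
  simp [fieldDeriv, this.fderiv_eq]

lemma Annular.rad {w : EuclideanSpace ℝ (Fin N) → ℝ} (hw : Annular w) :
    Annular (radDeriv w) :=
  hw.along fun _ _ => contDiffAt_id

lemma RadialCutoff.mul_norm_rpow {w : EuclideanSpace ℝ (Fin N) → ℝ} (hw : RadialCutoff w)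
    (p : ℝ) : RadialCutoff (fun x => w x * ‖x‖ ^ p) where
  toAnnular := hw.toAnnular.mul (SmoothOff.norm_rpow p)
  ang j x hx := by
    rw [fieldDeriv_mul hw.smooth (SmoothOff.norm_rpow p) hx, hw.ang j x hx,
      angDeriv_norm_rpow j p hx]
    ring

lemma Annular.integral_partialDeriv {w : EuclideanSpace ℝ (Fin N) → ℝ} (hw : Annular w)
    (j : Fin N) : ∫ x, partialDeriv j w x = 0 := by
  have h : Annular (partialDeriv j w) :=
    hw.along (V := fun _ => EuclideanSpace.single j 1) fun _ _ => contDiffAt_const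
  have := integral_mul_fderiv_eq_neg_fderiv_mul_of_integrable (𝕜 := ℝ) (μ := volume)
    (f := fun _ : EuclideanSpace ℝ (Fin N) => (1 : ℝ)) (g := w) (v := EuclideanSpace.single j 1)
    (by simp) (by simpa using! h.integrable) (by simpa using hw.integrable)
    (by fun_prop) (fun x _ => hw.contDiff.differentiable (by simp) x)
  simpa using! this

lemma partialDeriv_mul {f g : EuclideanSpace ℝ (Fin N) → ℝ} (hf : SmoothOff f)
    (hg : SmoothOff g) (j : Fin N) {x : EuclideanSpace ℝ (Fin N)} (hx : x ≠ 0) :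
    partialDeriv j (fun y => f y * g y) x = partialDeriv j f x * g x + f x * partialDeriv j g x :=
  fieldDeriv_mul (V := fun _ => EuclideanSpace.single j 1) hf hg hx

lemma SmoothOff.pderiv {f : EuclideanSpace ℝ (Fin N) → ℝ} (hf : SmoothOff f)
    (j : Fin N) : SmoothOff (partialDeriv j f) :=
  hf.along (V := fun _ => EuclideanSpace.single j 1) fun _ _ => contDiffAt_const

lemma Annular.pderiv {w : EuclideanSpace ℝ (Fin N) → ℝ} (hw : Annular w)
    (j : Fin N) : Annular (partialDeriv j w) :=
  hw.along (V := fun _ => EuclideanSpace.single j 1) fun _ _ => contDiffAt_const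

/-- Two annular functions have to be compared off the origin only. -/
lemma Annular.ext {w v : EuclideanSpace ℝ (Fin N) → ℝ} (hw : Annular w) (hv : Annular v)
    (h : ∀ x, x ≠ 0 → w x = v x) : w = v := by
  funext x
  by_cases hx : x = 0
  · rw [hx, hw.zero, hv.zero]
  · exact h x hx

/-- The Euler field has divergence `N`. -/
lemma Annular.integral_radDeriv {w : EuclideanSpace ℝ (Fin N) → ℝ} (hw : Annular w) :
    ∫ x, radDeriv w x = -N * ∫ x, w x := by
  have h : ∀ x, radDeriv w x =
      ∑ j, partialDeriv j (fun y => w y * y j) x - N * w x := by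
    intro x
    have hp : ∀ j, partialDeriv j (fun y => w y * y j) x
        = partialDeriv j w x * x j + w x := by
      intro j
      have h1 := (hw.contDiff.differentiable (by simp) x).hasFDerivAt
      have h2 : HasFDerivAt (fun y : EuclideanSpace ℝ (Fin N) => y j)
        (EuclideanSpace.proj j : EuclideanSpace ℝ (Fin N) →L[ℝ] ℝ) x :=
        (EuclideanSpace.proj (𝕜 := ℝ) j).hasFDerivAt
      simp only [partialDeriv, (h1.fun_mul h2).fderiv]
      simp; ring
    rw [radDeriv_eq_sum]
    simp only [hp, Finset.sum_add_distrib]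
    simp [mul_comm]
  simp only [h]
  have hI : ∀ j : Fin N, Annular (fun y => w y * y j) := fun j => hw.mul (SmoothOff.coord j)
  rw [integral_sub (integrable_finsetSum _ fun j _ => ((hI j).pderiv j).integrable)
    (hw.integrable.const_mul _), integral_finsetSum _ fun j _ => ((hI j).pderiv j).integrable]
  simp only [(hI _).integral_partialDeriv, integral_const_mul]
  simp

/-- The field `angField j` has divergence `-(N - 1) dir j`. -/
lemma Annular.integral_angDeriv {w : EuclideanSpace ℝ (Fin N) → ℝ} (hw : Annular w)
    (j : Fin N) : ∫ x, angDeriv j w x = ((N : ℝ) - 1) * ∫ x, w x * dir j x := by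
  have h1 : Annular (fun y => w y * ‖y‖) := hw.mul SmoothOff.norm
  have h2 : Annular (fun y => w y * dir j y) := hw.mul (SmoothOff.dir j)
  have h : ∀ x, angDeriv j w x = partialDeriv j (fun y => w y * ‖y‖) x - w x * dir j x
      - radDeriv (fun y => w y * dir j y) x := by
    intro x
    by_cases hx : x = 0
    · rw [hx, h2.rad.zero, (h1.pderiv j).zero, hw.zero,
        (hw.along fun _ hx => contDiffAt_angField j hx).zero]
      ring
    · rw [partialDeriv_mul hw.smooth SmoothOff.norm j hx, fieldDeriv_mul hw.smooth
        (SmoothOff.dir j) hx, radDeriv_dir j hx, partialDeriv_norm j hx, fieldDeriv_angField]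
      ring
  simp only [h]
  rw [integral_sub (by exact (h1.pderiv j).integrable.sub h2.integrable) h2.rad.integrable,
    integral_sub (h1.pderiv j).integrable h2.integrable, h1.integral_partialDeriv,
    h2.integral_radDeriv]
  ring

/-- The integral of `f` against the weight `w`. -/
noncomputable def wInt (w f : EuclideanSpace ℝ (Fin N) → ℝ) : ℝ := ∫ x, w x * f x

lemma Annular.wInt_congr {w f g : EuclideanSpace ℝ (Fin N) → ℝ} (hw : Annular w)
    (h : ∀ x, x ≠ 0 → f x = g x) : wInt w f = wInt w g := by
  refine integral_congr_ae (Eventually.of_forall fun x => ?_)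
  by_cases hx : x = 0
  · simp [hx, hw.zero]
  · simp [h x hx]

lemma Annular.wInt_add {w f g : EuclideanSpace ℝ (Fin N) → ℝ} (hw : Annular w)
    (hf : SmoothOff f) (hg : SmoothOff g) :
    wInt w (fun x => f x + g x) = wInt w f + wInt w g := by
  simp only [wInt, mul_add]
  exact integral_add (hw.mul hf).integrable (hw.mul hg).integrable

lemma Annular.wInt_sub {w f g : EuclideanSpace ℝ (Fin N) → ℝ} (hw : Annular w)
    (hf : SmoothOff f) (hg : SmoothOff g) :
    wInt w (fun x => f x - g x) = wInt w f - wInt w g := by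
  simp only [wInt, mul_sub]
  exact integral_sub (hw.mul hf).integrable (hw.mul hg).integrable

lemma wInt_const_mul {w f : EuclideanSpace ℝ (Fin N) → ℝ} (c : ℝ) :
    wInt w (fun x => c * f x) = c * wInt w f := by
  simp only [wInt, mul_left_comm _ c]
  exact integral_const_mul _ _

lemma Annular.wInt_sum {w : EuclideanSpace ℝ (Fin N) → ℝ} (hw : Annular w) {ι : Type*}
    {s : Finset ι} {f : ι → EuclideanSpace ℝ (Fin N) → ℝ} (hf : ∀ i ∈ s, SmoothOff (f i)) :
    wInt w (fun x => ∑ i ∈ s, f i x) = ∑ i ∈ s, wInt w (f i) := by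
  simp only [wInt, Finset.mul_sum]
  exact integral_finsetSum _ fun i hi => (hw.mul (hf i hi)).integrable

lemma Annular.wInt_mono {w f g : EuclideanSpace ℝ (Fin N) → ℝ} (hw : Annular w)
    (h0 : ∀ x, 0 ≤ w x) (hf : SmoothOff f) (hg : SmoothOff g)
    (h : ∀ x, x ≠ 0 → f x ≤ g x) : wInt w f ≤ wInt w g := by
  refine integral_mono (hw.mul hf).integrable (hw.mul hg).integrable fun x => ?_
  by_cases hx : x = 0
  · simp [hx, hw.zero]
  · exact mul_le_mul_of_nonneg_left (h x hx) (h0 x)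

lemma RadialCutoff.wInt_angDeriv {w f : EuclideanSpace ℝ (Fin N) → ℝ} (hw : RadialCutoff w)
    (hf : SmoothOff f) (j : Fin N) :
    wInt w (angDeriv j f) = ((N : ℝ) - 1) * wInt w (fun x => dir j x * f x) := by
  have h := (hw.toAnnular.mul hf).integral_angDeriv j
  rw [wInt, wInt]
  convert h using 3 with x
  · refine congrFun ((hw.toAnnular.mul (hf.ang j)).ext
      ((hw.toAnnular.mul hf).along fun _ hx => contDiffAt_angField j hx) fun x hx => ?_) x
    rw [fieldDeriv_mul hw.smooth hf hx, hw.ang j x hx]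
    ring
  · ext x; ring

lemma Annular.wInt_radDeriv {w f : EuclideanSpace ℝ (Fin N) → ℝ} (hw : Annular w)
    (hf : SmoothOff f) :
    wInt w (radDeriv f) = -wInt (radDeriv w) f - N * wInt w f := by
  have h := (hw.mul hf).integral_radDeriv
  have h2 : ∀ x, radDeriv (fun y => w y * f y) x = radDeriv w x * f x + w x * radDeriv f x := by
    intro x
    by_cases hx : x = 0
    · subst hx
      have h0 : ∀ g : EuclideanSpace ℝ (Fin N) → ℝ, radDeriv g 0 = 0 := fun g => by
        simp [fieldDeriv, radField]
      simp [h0, hw.zero]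
    · exact fieldDeriv_mul hw.smooth hf hx
  simp only [h2] at h
  rw [integral_add (hw.rad.mul hf).integrable (hw.mul hf.rad).integrable] at h
  simp only [wInt]
  linarith

end CKN

namespace CKN

variable {N : ℕ}

/-! ### The Bochner identity on spheres -/

/-- The `(i, k)` entry of the spherical Hessian of `f`, as a symmetric tangential matrix; the term
`dir i x * angDeriv k f x` removes the normal part of the derivative of the spherical gradient. -/
noncomputable def sphHess (f : EuclideanSpace ℝ (Fin N) → ℝ) (i k : Fin N)
    (x : EuclideanSpace ℝ (Fin N)) : ℝ :=
  angDeriv k (angDeriv i f) x + dir i x * angDeriv k f x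

/-- The spherical Laplacian. -/
noncomputable def sphLap (f : EuclideanSpace ℝ (Fin N) → ℝ) (x : EuclideanSpace ℝ (Fin N)) : ℝ :=
  ∑ k, angDeriv k (angDeriv k f) x

@[fun_prop]
lemma SmoothOff.sphHess {f : EuclideanSpace ℝ (Fin N) → ℝ} (hf : SmoothOff f) (i k : Fin N) :
    SmoothOff (sphHess f i k) := by
  unfold CKN.sphHess; fun_prop

@[fun_prop]
lemma SmoothOff.sphLap {f : EuclideanSpace ℝ (Fin N) → ℝ} (hf : SmoothOff f) :
    SmoothOff (sphLap f) := by
  unfold CKN.sphLap; fun_prop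

lemma sphHess_symm {f : EuclideanSpace ℝ (Fin N) → ℝ} (hf : SmoothOff f) (i k : Fin N)
    {x : EuclideanSpace ℝ (Fin N)} (hx : x ≠ 0) : sphHess f i k x = sphHess f k i x := by
  rw [sphHess, sphHess, angDeriv_comm i k hf hx]; ring

lemma sum_dir_mul_angDeriv_angDeriv {f : EuclideanSpace ℝ (Fin N) → ℝ} (hf : SmoothOff f)
    (k : Fin N) {x : EuclideanSpace ℝ (Fin N)} (hx : x ≠ 0) :
    ∑ i, dir i x * angDeriv k (angDeriv i f) x = -angDeriv k f x := by
  have h : angDeriv k (fun y => ∑ i, dir i y * angDeriv i f y) x = 0 := by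
    rw [fieldDeriv_congr (g := fun _ => 0) (fun y hy => sum_dir_mul_angDeriv f hy) hx,
      fieldDeriv_const]
  rw [fieldDeriv_sum (fun i _ => by fun_prop) hx] at h
  have h2 : ∀ i, angDeriv k (fun y => dir i y * angDeriv i f y) x =
      (if i = k then angDeriv i f x else 0) - dir k x * (dir i x * angDeriv i f x)
        + dir i x * angDeriv k (angDeriv i f) x := by
    intro i
    rw [fieldDeriv_mul (by fun_prop) (by fun_prop) hx, angDeriv_dir k i hx]
    split_ifs <;> ring
  simp only [h2, Finset.sum_add_distrib, Finset.sum_sub_distrib, ← Finset.mul_sum,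
    sum_dir_mul_angDeriv f hx] at h
  simp at h
  linarith

lemma sum_dir_mul_sphHess {f : EuclideanSpace ℝ (Fin N) → ℝ} (hf : SmoothOff f) (k : Fin N)
    {x : EuclideanSpace ℝ (Fin N)} (hx : x ≠ 0) : ∑ i, dir i x * sphHess f i k x = 0 := by
  have h : ∀ i, dir i x * sphHess f i k x = dir i x * angDeriv k (angDeriv i f) x +
      dir i x ^ 2 * angDeriv k f x := fun i => by rw [sphHess]; ring
  simp only [h, Finset.sum_add_distrib, ← Finset.sum_mul, sum_dir_sq hx,
    sum_dir_mul_angDeriv_angDeriv hf k hx]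
  ring

lemma sum_sphHess_self {f : EuclideanSpace ℝ (Fin N) → ℝ}
    {x : EuclideanSpace ℝ (Fin N)} (hx : x ≠ 0) : ∑ i, sphHess f i i x = sphLap f x := by
  simp only [sphHess, Finset.sum_add_distrib, sum_dir_mul_angDeriv f hx, add_zero, sphLap]

/-- The squared norm of the spherical Hessian is the sum of the products of mixed second
derivatives, the shape in which integration by parts applies. -/
lemma sum_sphHess_sq {f : EuclideanSpace ℝ (Fin N) → ℝ} (hf : SmoothOff f)
    {x : EuclideanSpace ℝ (Fin N)} (hx : x ≠ 0) :
    ∑ i, ∑ k, sphHess f i k x ^ 2 =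
      ∑ i, ∑ k, angDeriv i (angDeriv k f) x * angDeriv k (angDeriv i f) x := by
  have h : ∀ i k, sphHess f i k x ^ 2 =
      angDeriv i (angDeriv k f) x * angDeriv k (angDeriv i f) x
      + angDeriv i f x * (dir k x * angDeriv k (angDeriv i f) x)
      + angDeriv k f x * (dir i x * sphHess f k i x) := by
    intro i k
    have h1 := sphHess_symm hf i k hx
    have h2 : sphHess f i k x ^ 2 = sphHess f i k x * sphHess f k i x := by rw [← h1]; ring
    rw [h2]; simp only [sphHess]; ring
  have h3 : ∑ i, ∑ k, angDeriv k f x * (dir i x * sphHess f k i x) = 0 := by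
    rw [Finset.sum_comm]
    simp only [← Finset.mul_sum]
    refine Finset.sum_eq_zero fun k _ => ?_
    simp only [sphHess_symm hf k _ hx, sum_dir_mul_sphHess hf k hx, mul_zero]
  simp only [h, Finset.sum_add_distrib, h3, ← Finset.mul_sum, sum_dir_mul_angDeriv _ hx]
  simp

/-- Integration by parts twice. The dimension enters as `N - 2`: each integration by parts
contributes `N - 1`, and the commutator of the spherical fields takes one away. -/
lemma RadialCutoff.wInt_mixed {w f : EuclideanSpace ℝ (Fin N) → ℝ} (hw : RadialCutoff w)
    (hf : SmoothOff f) (i k : Fin N) :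
    wInt w (fun x => angDeriv i (angDeriv k f) x * angDeriv k (angDeriv i f) x) =
      wInt w (fun x => angDeriv k (angDeriv k f) x * angDeriv i (angDeriv i f) x
        + ((N : ℝ) - 2) * (angDeriv k f x * (dir i x * angDeriv k (angDeriv i f) x)
            - dir k x * angDeriv k f x * angDeriv i (angDeriv i f) x)) := by
  have hA := hw.toAnnular
  have hF := hw.wInt_angDeriv
    (f := fun x => angDeriv k f x * angDeriv k (angDeriv i f) x) (by fun_prop) i
  have hG := hw.wInt_angDeriv
    (f := fun x => angDeriv k f x * angDeriv i (angDeriv i f) x) (by fun_prop) k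
  rw [← wInt_const_mul, ← sub_eq_zero, ← hA.wInt_sub (by fun_prop) (by fun_prop)] at hF hG
  rw [← sub_eq_zero, ← hA.wInt_sub (by fun_prop) (by fun_prop), ← sub_zero (0 : ℝ)]
  nth_rewrite 1 [← hF]
  rw [← hG, ← hA.wInt_sub (by fun_prop) (by fun_prop)]
  refine hA.wInt_congr fun x hx => ?_
  rw [fieldDeriv_mul (by fun_prop) (by fun_prop) hx,
    fieldDeriv_mul (by fun_prop) (by fun_prop) hx, angDeriv_comm i k (hf.ang i) hx]
  ring

/-- Bochner identity on spheres of dimension `N - 1`, integrated against a radial weight. -/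
lemma RadialCutoff.bochner {w f : EuclideanSpace ℝ (Fin N) → ℝ} (hw : RadialCutoff w)
    (hf : SmoothOff f) :
    wInt w (fun x => ∑ i, ∑ k, sphHess f i k x ^ 2) =
      wInt w (fun x => sphLap f x ^ 2)
        - ((N : ℝ) - 2) * wInt w (fun x => ∑ i, angDeriv i f x ^ 2) := by
  have hA := hw.toAnnular
  rw [hA.wInt_congr fun x hx => sum_sphHess_sq hf hx, hA.wInt_sum fun i _ => by fun_prop,
    Finset.sum_congr rfl fun i _ => hA.wInt_sum fun k _ => by fun_prop]
  simp only [hw.wInt_mixed hf]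
  rw [← Finset.sum_congr rfl fun i _ => hA.wInt_sum fun k _ => by fun_prop,
    ← hA.wInt_sum fun i _ => by fun_prop, ← wInt_const_mul,
    ← hA.wInt_sub (by fun_prop) (by fun_prop)]
  refine hA.wInt_congr fun x hx => ?_
  have h1 : ∑ i, ∑ k, angDeriv k f x * (dir i x * angDeriv k (angDeriv i f) x) =
      -∑ i, angDeriv i f x ^ 2 := by
    rw [Finset.sum_comm]
    simp only [← Finset.mul_sum, sum_dir_mul_angDeriv_angDeriv hf _ hx, ← Finset.sum_neg_distrib]
    exact Finset.sum_congr rfl fun i _ => by ring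
  have h2 : ∑ i, ∑ k, dir k x * angDeriv k f x * angDeriv i (angDeriv i f) x = 0 := by
    simp only [← Finset.sum_mul, sum_dir_mul_angDeriv f hx, zero_mul, Finset.sum_const_zero]
  have h3 : ∑ i, ∑ k, angDeriv k (angDeriv k f) x * angDeriv i (angDeriv i f) x
      = sphLap f x ^ 2 := by
    simp only [← Finset.sum_mul, ← Finset.mul_sum, sphLap, sq]
  simp only [Finset.sum_add_distrib, ← Finset.mul_sum, Finset.sum_sub_distrib, h1, h2, h3]
  ring

/-- The spherical Hessian is tangential, so that its trace is controlled with the dimension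
`N - 1` of the sphere. -/
lemma sphLap_sq_le {f : EuclideanSpace ℝ (Fin N) → ℝ} (hf : SmoothOff f)
    {x : EuclideanSpace ℝ (Fin N)} (hx : x ≠ 0) (hN : 2 ≤ N) :
    sphLap f x ^ 2 ≤ ((N : ℝ) - 1) * ∑ i, ∑ k, sphHess f i k x ^ 2 := by
  have hN' : (0 : ℝ) < (N : ℝ) - 1 := by
    have : (2 : ℝ) ≤ N := by exact_mod_cast hN
    linarith
  set l := sphLap f x
  set c := l / ((N : ℝ) - 1) with hc
  -- the squared norm of the trace-free part, `δ - dir ⊗ dir` being the tangential projection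
  have h0 : 0 ≤ ∑ i, ∑ k, (sphHess f i k x - c * ((if i = k then 1 else 0)
      - dir i x * dir k x)) ^ 2 :=
    Finset.sum_nonneg fun i _ => Finset.sum_nonneg fun k _ => sq_nonneg _
  have h : ∀ i k, (sphHess f i k x - c * ((if i = k then 1 else 0) - dir i x * dir k x)) ^ 2 =
      sphHess f i k x ^ 2 - 2 * c * (if i = k then sphHess f i k x else 0)
      + 2 * c * (dir k x * (dir i x * sphHess f i k x))
      + c ^ 2 * (if i = k then 1 else 0) - 2 * c ^ 2 * (if i = k then dir i x * dir k x else 0)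
      + c ^ 2 * (dir i x ^ 2 * dir k x ^ 2) := by
    intro i k
    split_ifs <;> ring
  have h2 : ∑ i, ∑ k, dir k x * (dir i x * sphHess f i k x) = 0 := by
    rw [Finset.sum_comm]
    simp only [← Finset.mul_sum, sum_dir_mul_sphHess hf _ hx, mul_zero, Finset.sum_const_zero]
  simp only [h, Finset.sum_add_distrib, Finset.sum_sub_distrib, ← Finset.mul_sum, h2,
    Finset.sum_ite_eq, Finset.mem_univ, if_true, sum_sphHess_self hx, sum_dir_sq hx, ← sq,
    Finset.sum_const, Finset.card_univ, Fintype.card_fin, nsmul_eq_mul, mul_one] at h0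
  have h3 : l = c * ((N : ℝ) - 1) := by rw [hc]; field_simp
  change 0 ≤ _ - 2 * c * l + _ + _ - _ + _ at h0
  rw [h3] at h0 ⊢
  nlinarith

end CKN

namespace CKN

variable {N : ℕ}

/-! ### Wirtinger's inequality and the circle -/

/-- Wirtinger's inequality on the circle, by Parseval's identity. -/
lemma wirtinger {g g' : ℝ → ℝ} (hg : ∀ x, HasDerivAt g (g' x) x) (hg' : Continuous g')
    (hper : g (-Real.pi) = g Real.pi) (hmean : ∫ x in (-Real.pi)..Real.pi, g x = 0) :
    ∫ x in (-Real.pi)..Real.pi, g x ^ 2 ≤ ∫ x in (-Real.pi)..Real.pi, g' x ^ 2 := by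
  have hpi := Real.pi_pos
  have hab : -Real.pi < Real.pi := by linarith
  have hgc : Continuous g := continuous_iff_continuousAt.2 fun x => (hg x).continuousAt
  have hL2 : ∀ {h : ℝ → ℝ}, Continuous h →
      MemLp (fun x => (h x : ℂ)) 2 (volume.restrict (Set.Ioc (-Real.pi) Real.pi)) := by
    intro h hh
    obtain ⟨C, hC⟩ := (isCompact_Icc (a := -Real.pi) (b := Real.pi)).exists_bound_of_continuousOn
      (Complex.continuous_ofReal.comp hh).continuousOn
    refine MemLp.of_bound (Complex.continuous_ofReal.comp hh).aestronglyMeasurable C ?_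
    filter_upwards [ae_restrict_mem measurableSet_Ioc] with x hx
    exact hC x (Set.Ioc_subset_Icc_self hx)
  have h1 := hasSum_sq_fourierCoeffOn hab (hL2 hgc)
  have h2 := hasSum_sq_fourierCoeffOn hab (hL2 hg')
  have hle : ∀ n : ℤ, ‖fourierCoeffOn hab (fun x => (g x : ℂ)) n‖ ^ 2 ≤
      ‖fourierCoeffOn hab (fun x => (g' x : ℂ)) n‖ ^ 2 := by
    intro n
    by_cases hn : n = 0
    · have : fourierCoeffOn hab (fun x => (g x : ℂ)) 0 = 0 := by
        rw [fourierCoeffOn_eq_integral]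
        simp [intervalIntegral.integral_ofReal, hmean]
      rw [hn, this]
      simp
    · have h := fourierCoeffOn_of_hasDerivAt hab (f := fun x => (g x : ℂ))
        (f' := fun x => (g' x : ℂ)) hn (fun x _ => (hg x).ofReal_comp)
        ((Complex.continuous_ofReal.comp hg').intervalIntegrable _ _)
      rw [h, hper, sub_self, mul_zero, zero_sub, norm_mul]
      have hn1 : (1 : ℝ) ≤ |(n : ℝ)| := by exact_mod_cast Int.one_le_abs hn
      have h3 : ‖(1 : ℂ) / (-2 * Real.pi * Complex.I * n)‖ = 1 / (2 * Real.pi * |(n : ℝ)|) := by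
        simp [abs_of_pos hpi]
      have h4 : ‖-(((Real.pi : ℝ) : ℂ) - ((-Real.pi : ℝ) : ℂ)) *
          fourierCoeffOn hab (fun x => (g' x : ℂ)) n‖ =
          2 * Real.pi * ‖fourierCoeffOn hab (fun x => (g' x : ℂ)) n‖ := by
        have : -(((Real.pi : ℝ) : ℂ) - ((-Real.pi : ℝ) : ℂ)) = ((-(2 * Real.pi) : ℝ) : ℂ) := by
          push_cast; ring
        rw [norm_mul, this, Complex.norm_real, Real.norm_eq_abs, abs_neg,
          abs_of_pos (by positivity)]
      rw [neg_mul_eq_neg_mul, h3, h4]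
      refine pow_le_pow_left₀ (by positivity) ?_ 2
      rw [div_mul_eq_mul_div, one_mul, div_le_iff₀ (by positivity)]
      have := norm_nonneg (fourierCoeffOn hab (fun x => (g' x : ℂ)) n)
      nlinarith [mul_nonneg hpi.le this]
  have h3 := hasSum_le hle h1 h2
  have h4 : (0 : ℝ) < (Real.pi - -Real.pi)⁻¹ := by
    apply inv_pos.2; linarith
  simp only [smul_eq_mul, Complex.norm_real, Real.norm_eq_abs, sq_abs] at h3
  exact le_of_mul_le_mul_left h3 h4

/-- The rotation field of the plane. -/
noncomputable def rotField (x : EuclideanSpace ℝ (Fin 2)) : EuclideanSpace ℝ (Fin 2) :=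
  x 0 • EuclideanSpace.single 1 (1 : ℝ) - x 1 • EuclideanSpace.single 0 (1 : ℝ)

lemma contDiff_rotField : ContDiff ℝ ∞ rotField :=
  ((EuclideanSpace.proj (𝕜 := ℝ) (0 : Fin 2)).contDiff.smul
    (contDiff_const (c := EuclideanSpace.single (1 : Fin 2) (1 : ℝ)))).sub
    ((EuclideanSpace.proj (𝕜 := ℝ) (1 : Fin 2)).contDiff.smul
      (contDiff_const (c := EuclideanSpace.single (0 : Fin 2) (1 : ℝ))))

@[fun_prop]
lemma SmoothOff.rot {f : EuclideanSpace ℝ (Fin 2) → ℝ} (hf : SmoothOff f) :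
    SmoothOff (fieldDeriv rotField f) :=
  hf.along fun _ _ => contDiff_rotField.contDiffAt

lemma dir_zero_sq_add_dir_one_sq {x : EuclideanSpace ℝ (Fin 2)} (hx : x ≠ 0) :
    dir 0 x ^ 2 + dir 1 x ^ 2 = 1 := by
  simpa [Fin.sum_univ_two] using sum_dir_sq hx

lemma angDeriv_zero_eq_rot (f : EuclideanSpace ℝ (Fin 2) → ℝ) {x : EuclideanSpace ℝ (Fin 2)}
    (hx : x ≠ 0) : angDeriv 0 f x = -dir 1 x * fieldDeriv rotField f x := by
  have h : angField 0 x = (-dir 1 x) • rotField x := by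
    have h1 := norm_mul_dir 0 hx
    have h2 := norm_mul_dir 1 hx
    have h3 := dir_zero_sq_add_dir_one_sq hx
    ext i
    fin_cases i
    · simp [angField, rotField]
      rw [← h1, ← h2]
      rw [mul_div_cancel_left₀ _ (norm_ne_zero_iff.2 hx)]
      linear_combination (-‖x‖) * h3
    · simp [angField, rotField, dir]
      ring
  simp [fieldDeriv, h]

lemma angDeriv_one_eq_rot (f : EuclideanSpace ℝ (Fin 2) → ℝ) {x : EuclideanSpace ℝ (Fin 2)}
    (hx : x ≠ 0) : angDeriv 1 f x = dir 0 x * fieldDeriv rotField f x := by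
  have h : angField 1 x = (dir 0 x) • rotField x := by
    have h1 := norm_mul_dir 0 hx
    have h2 := norm_mul_dir 1 hx
    have h3 := dir_zero_sq_add_dir_one_sq hx
    ext i
    fin_cases i
    · simp [angField, rotField, dir]
      ring
    · simp [angField, rotField]
      rw [← h1, ← h2]
      rw [mul_div_cancel_left₀ _ (norm_ne_zero_iff.2 hx)]
      linear_combination (-‖x‖) * h3
  simp [fieldDeriv, h]

lemma sum_angDeriv_sq_eq_rot (f : EuclideanSpace ℝ (Fin 2) → ℝ) {x : EuclideanSpace ℝ (Fin 2)}
    (hx : x ≠ 0) : ∑ i, angDeriv i f x ^ 2 = fieldDeriv rotField f x ^ 2 := by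
  rw [Fin.sum_univ_two, angDeriv_zero_eq_rot f hx, angDeriv_one_eq_rot f hx]
  linear_combination fieldDeriv rotField f x ^ 2 * dir_zero_sq_add_dir_one_sq hx

lemma sphLap_eq_rot {f : EuclideanSpace ℝ (Fin 2) → ℝ} (hf : SmoothOff f)
    {x : EuclideanSpace ℝ (Fin 2)} (hx : x ≠ 0) :
    sphLap f x = fieldDeriv rotField (fieldDeriv rotField f) x := by
  have h0 : fieldDeriv rotField (angDeriv 0 f) x =
      -(fieldDeriv rotField (dir 1) x * fieldDeriv rotField f x +
        dir 1 x * fieldDeriv rotField (fieldDeriv rotField f) x) := by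
    rw [fieldDeriv_congr (g := fun y => (-1) * (dir 1 y * fieldDeriv rotField f y))
      (fun y hy => by rw [angDeriv_zero_eq_rot f hy]; ring) hx,
      fieldDeriv_mul (by fun_prop) (by fun_prop) hx, fieldDeriv_const,
      fieldDeriv_mul (by fun_prop) (by fun_prop) hx]
    ring
  have h1 : fieldDeriv rotField (angDeriv 1 f) x =
      fieldDeriv rotField (dir 0) x * fieldDeriv rotField f x +
        dir 0 x * fieldDeriv rotField (fieldDeriv rotField f) x := by
    rw [fieldDeriv_congr (g := fun y => dir 0 y * fieldDeriv rotField f y)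
      (fun y hy => angDeriv_one_eq_rot f hy) hx,
      fieldDeriv_mul (by fun_prop) (by fun_prop) hx]
  have h2 : fieldDeriv rotField (fun y => dir 0 y * dir 0 y + dir 1 y * dir 1 y) x = 0 := by
    rw [fieldDeriv_congr (g := fun _ => 1)
      (fun y hy => by rw [← dir_zero_sq_add_dir_one_sq hy]; ring) hx, fieldDeriv_const]
  rw [fieldDeriv_add (by fun_prop) (by fun_prop) hx, fieldDeriv_mul (by fun_prop) (by fun_prop) hx,
    fieldDeriv_mul (by fun_prop) (by fun_prop) hx] at h2
  rw [sphLap, Fin.sum_univ_two, angDeriv_zero_eq_rot _ hx, angDeriv_one_eq_rot _ hx, h0, h1]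
  linear_combination fieldDeriv rotField (fieldDeriv rotField f) x * dir_zero_sq_add_dir_one_sq hx
    + (fieldDeriv rotField f x / 2) * h2

/-- The circle of radius `r` in polar coordinates. -/
noncomputable def circleCurve (r θ : ℝ) : EuclideanSpace ℝ (Fin 2) :=
  (r * Real.cos θ) • EuclideanSpace.single 0 (1 : ℝ) +
    (r * Real.sin θ) • EuclideanSpace.single 1 (1 : ℝ)

lemma hasDerivAt_circleCurve (r θ : ℝ) :
    HasDerivAt (circleCurve r) (rotField (circleCurve r θ)) θ := by
  have h := (((Real.hasDerivAt_cos θ).const_mul r).smul_const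
    (EuclideanSpace.single (0 : Fin 2) (1 : ℝ))).add
    (((Real.hasDerivAt_sin θ).const_mul r).smul_const (EuclideanSpace.single (1 : Fin 2) (1 : ℝ)))
  refine h.congr_deriv ?_
  ext i
  fin_cases i <;> simp [rotField, circleCurve]

lemma circleCurve_ne_zero {r : ℝ} (hr : 0 < r) (θ : ℝ) : circleCurve r θ ≠ 0 := by
  intro h
  have h0 : r * Real.cos θ = 0 := by
    simpa [circleCurve] using congrArg (fun v : EuclideanSpace ℝ (Fin 2) => v 0) h
  have h1 : r * Real.sin θ = 0 := by
    simpa [circleCurve] using congrArg (fun v : EuclideanSpace ℝ (Fin 2) => v 1) h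
  have := Real.sin_sq_add_cos_sq θ
  have h2 : r ^ 2 * (Real.sin θ ^ 2 + Real.cos θ ^ 2) = 0 := by
    linear_combination (r * Real.cos θ) * h0 + (r * Real.sin θ) * h1
  rw [this] at h2
  nlinarith

lemma hasDerivAt_comp_circleCurve {f : EuclideanSpace ℝ (Fin 2) → ℝ} (hf : SmoothOff f) {r : ℝ}
    (hr : 0 < r) (θ : ℝ) : HasDerivAt (fun t => f (circleCurve r t))
      (fieldDeriv rotField f (circleCurve r θ)) θ :=
  ((hf.differentiableAt (circleCurve_ne_zero hr θ)).hasFDerivAt).comp_hasDerivAt θ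
    (hasDerivAt_circleCurve r θ)

lemma continuous_comp_circleCurve {f : EuclideanSpace ℝ (Fin 2) → ℝ} (hf : SmoothOff f) {r : ℝ}
    (hr : 0 < r) : Continuous (fun t => f (circleCurve r t)) :=
  continuous_iff_continuousAt.2 fun θ => (hasDerivAt_comp_circleCurve hf hr θ).continuousAt

lemma circle_wirtinger {f : EuclideanSpace ℝ (Fin 2) → ℝ} (hf : SmoothOff f) {r : ℝ}
    (hr : 0 < r) :
    ∫ θ in (-Real.pi)..Real.pi, fieldDeriv rotField f (circleCurve r θ) ^ 2 ≤
      ∫ θ in (-Real.pi)..Real.pi,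
        fieldDeriv rotField (fieldDeriv rotField f) (circleCurve r θ) ^ 2 := by
  have hp : circleCurve r (-Real.pi) = circleCurve r Real.pi := by simp [circleCurve]
  refine wirtinger (hasDerivAt_comp_circleCurve hf.rot hr)
    (continuous_comp_circleCurve hf.rot.rot hr) (by rw [hp]) ?_
  rw [intervalIntegral.integral_eq_sub_of_hasDerivAt
    (fun θ _ => hasDerivAt_comp_circleCurve hf hr θ)
    ((continuous_comp_circleCurve hf.rot hr).intervalIntegrable _ _), hp, sub_self]

lemma integral_eq_polar (F : EuclideanSpace ℝ (Fin 2) → ℝ) :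
    ∫ x, F x = ∫ p in Set.Ioi (0 : ℝ) ×ˢ Set.Ioo (-Real.pi) Real.pi,
      p.1 * F (circleCurve p.1 p.2) := by
  rw [← (PiLp.volume_preserving_toLp (Fin 2)).integral_comp
    (MeasurableEquiv.toLp 2 (Fin 2 → ℝ)).measurableEmbedding,
    ← (volume_preserving_finTwoArrow ℝ).symm.integral_comp
      (MeasurableEquiv.finTwoArrow (α := ℝ)).symm.measurableEmbedding,
    ← integral_comp_polarCoord_symm]
  simp only [polarCoord_target, smul_eq_mul]
  congr 1 with p
  congr 2
  ext i
  fin_cases i <;> simp [circleCurve, polarCoord, MeasurableEquiv.finTwoArrow]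

lemma RadialCutoff.circleCurve_const {w : EuclideanSpace ℝ (Fin 2) → ℝ} (hw : RadialCutoff w)
    {r : ℝ} (hr : 0 < r) (θ : ℝ) : w (circleCurve r θ) = w (circleCurve r 0) := by
  refine is_const_of_deriv_eq_zero (f := fun t => w (circleCurve r t))
    (fun t => (hasDerivAt_comp_circleCurve hw.smooth hr t).differentiableAt) (fun t => ?_) θ 0
  rw [(hasDerivAt_comp_circleCurve hw.smooth hr t).deriv]
  have hx := circleCurve_ne_zero hr t
  have h := sum_angDeriv_sq_eq_rot w hx
  simp only [hw.ang _ _ hx] at h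
  simpa using h.symm

/-- On the circle, `∫ |f'|² ≤ ∫ |f''|²`: Wirtinger's inequality for `f'`, which has mean zero. -/
lemma RadialCutoff.wInt_sum_angDeriv_sq_le_sphLap_sq {w f : EuclideanSpace ℝ (Fin 2) → ℝ}
    (hw : RadialCutoff w) (h0 : ∀ x, 0 ≤ w x) (hf : SmoothOff f) :
    wInt w (fun x => ∑ i, angDeriv i f x ^ 2) ≤ wInt w (fun x => sphLap f x ^ 2) := by
  have hA := hw.toAnnular
  rw [hA.wInt_congr fun x hx => sum_angDeriv_sq_eq_rot f hx,
    hA.wInt_congr (f := fun x => sphLap f x ^ 2)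
      (g := fun x => fieldDeriv rotField (fieldDeriv rotField f) x ^ 2)
      fun x hx => by rw [sphLap_eq_rot hf hx],
    ← sub_nonneg, ← hA.wInt_sub (by fun_prop) (by fun_prop), wInt, integral_eq_polar]
  rw [Measure.volume_eq_prod, ← Measure.prod_restrict]
  by_cases hI : Integrable (fun p : ℝ × ℝ => p.1 * (w (circleCurve p.1 p.2) *
      (fieldDeriv rotField (fieldDeriv rotField f) (circleCurve p.1 p.2) ^ 2 -
        fieldDeriv rotField f (circleCurve p.1 p.2) ^ 2)))
      ((volume.restrict (Set.Ioi 0)).prod (volume.restrict (Set.Ioo (-Real.pi) Real.pi)))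
  · rw [integral_prod _ hI]
    refine setIntegral_nonneg measurableSet_Ioi fun r hr => ?_
    simp only [Set.mem_Ioi] at hr
    simp only [hw.circleCurve_const hr]
    rw [integral_const_mul, integral_const_mul]
    refine mul_nonneg hr.le (mul_nonneg (h0 _) ?_)
    rw [← integral_Ioc_eq_integral_Ioo, ← intervalIntegral.integral_of_le
      (by linarith [Real.pi_pos]), intervalIntegral.integral_sub, sub_nonneg]
    · exact circle_wirtinger hf hr
    · exact ((continuous_comp_circleCurve hf.rot.rot hr).pow 2).intervalIntegrable _ _
    · exact ((continuous_comp_circleCurve hf.rot hr).pow 2).intervalIntegrable _ _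
  -- the integrand is in fact integrable; otherwise the integral is zero by convention
  · rw [integral_undef hI]

end CKN

namespace CKN

variable {N : ℕ}

/-! ### Hardy-type inequality for gradient fields -/

/-- In dimension `N ≥ 3` this is the Bochner identity combined with the trace inequality; on the
circle the Bochner identity carries no information and Wirtinger's inequality is used instead. -/
lemma RadialCutoff.wInt_grad_le_hess {w f : EuclideanSpace ℝ (Fin N) → ℝ} (hN : 1 ≤ N)
    (hw : RadialCutoff w) (h0 : ∀ x, 0 ≤ w x) (hf : SmoothOff f) :
    wInt w (fun x => ∑ i, angDeriv i f x ^ 2) ≤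
      wInt w (fun x => ∑ i, ∑ k, sphHess f i k x ^ 2) := by
  have hA := hw.toAnnular
  obtain rfl | hN2 := hN.eq_or_lt
  -- on the line the spherical gradient is tangential to a point, hence zero
  · refine hA.wInt_mono h0 (by fun_prop) (by fun_prop) fun x hx => ?_
    have h1 := sum_dir_sq hx
    have h2 := sum_dir_mul_angDeriv f hx
    simp only [Fin.sum_univ_one] at h1 h2 ⊢
    have h3 : angDeriv 0 f x ^ 2 = 0 := by
      linear_combination (-angDeriv 0 f x ^ 2) * h1 + dir 0 x * angDeriv 0 f x * h2
    rw [h3]; positivity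
  have hl : wInt w (fun x => sphLap f x ^ 2) ≤
      ((N : ℝ) - 1) * wInt w (fun x => ∑ i, ∑ k, sphHess f i k x ^ 2) := by
    rw [← wInt_const_mul]
    exact hA.wInt_mono h0 (by fun_prop) (by fun_prop) fun x hx => sphLap_sq_le hf hx hN2
  obtain h2 | hN3 := Nat.eq_or_lt_of_le (show 2 ≤ N from hN2)
  · have h2' : N = 2 := h2.symm
    subst h2'
    refine (hw.wInt_sum_angDeriv_sq_le_sphLap_sq h0 hf).trans (hl.trans_eq ?_)
    norm_num
  · have hb := hw.bochner hf
    have hN3' : (3 : ℝ) ≤ N := by exact_mod_cast hN3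
    have : ((N : ℝ) - 2) * wInt w (fun x => ∑ i, angDeriv i f x ^ 2) ≤
        ((N : ℝ) - 2) * wInt w (fun x => ∑ i, ∑ k, sphHess f i k x ^ 2) := by
      linarith
    exact le_of_mul_le_mul_left this (by linarith)

lemma norm_mul_partialDeriv (f : EuclideanSpace ℝ (Fin N) → ℝ) (i : Fin N)
    (x : EuclideanSpace ℝ (Fin N)) :
    ‖x‖ * partialDeriv i f x = angDeriv i f x + dir i x * radDeriv f x := by
  rw [fieldDeriv_angField]; ring

attribute [fun_prop] SmoothOff.pderiv

/-- Spherical derivatives of the gradient: a tangential symmetric part and a normal part. -/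
lemma norm_mul_angDeriv_partialDeriv {f : EuclideanSpace ℝ (Fin N) → ℝ} (hf : SmoothOff f)
    (i j : Fin N) {x : EuclideanSpace ℝ (Fin N)} (hx : x ≠ 0) :
    ‖x‖ * angDeriv j (partialDeriv i f) x =
      (sphHess f i j x + ((if i = j then 1 else 0) - dir i x * dir j x) * radDeriv f x) +
        dir i x * (angDeriv j (radDeriv f) x - angDeriv j f x) := by
  have h : angDeriv j (fun y => ‖y‖ * partialDeriv i f y) x =
      angDeriv j (fun y => angDeriv i f y + dir i y * radDeriv f y) x := by
    simp only [norm_mul_partialDeriv]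
  rw [fieldDeriv_mul (by fun_prop) (by fun_prop) hx, angDeriv_norm j hx,
    fieldDeriv_add (by fun_prop) (by fun_prop) hx, fieldDeriv_mul (by fun_prop) (by fun_prop) hx,
    angDeriv_dir j i hx] at h
  rw [sphHess]
  linear_combination h

/-- The angular part of `|D²f|²`, minus the spectral gap `N - 1` times `|∇f|²`, in terms of the
spherical gradient and Hessian of `f`. -/
lemma angular_energy_eq {f : EuclideanSpace ℝ (Fin N) → ℝ} (hf : SmoothOff f)
    {x : EuclideanSpace ℝ (Fin N)} (hx : x ≠ 0) :
    ‖x‖ ^ 2 * (∑ i, ∑ j, angDeriv j (partialDeriv i f) x ^ 2 -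
        ((N : ℝ) - 1) * ∑ i, partialDeriv i f x ^ 2) =
      ∑ i, ∑ k, sphHess f i k x ^ 2 + 2 * (radDeriv f x * sphLap f x)
        + ∑ j, ((radDeriv (angDeriv j f) x) ^ 2 - 2 * (radDeriv (angDeriv j f) x * angDeriv j f x)
        - ((N : ℝ) - 2) * angDeriv j f x ^ 2) := by
  set P := radDeriv f x
  have h : ∀ i j, ‖x‖ ^ 2 * angDeriv j (partialDeriv i f) x ^ 2 =
      sphHess f i j x ^ 2
      + 2 * P * (if i = j then sphHess f i j x else 0)
      - 2 * P * (dir j x * (dir i x * sphHess f i j x))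
      + (P ^ 2 * (if i = j then 1 else 0)
        - 2 * P ^ 2 * (if i = j then dir i x * dir j x else 0)
        + P ^ 2 * (dir i x ^ 2 * dir j x ^ 2))
      + 2 * ((radDeriv (angDeriv j f) x - angDeriv j f x) * (dir i x * sphHess f i j x))
      + (2 * P * (if i = j then dir i x * (radDeriv (angDeriv j f) x - angDeriv j f x) else 0)
        - 2 * P * (dir i x ^ 2 * (dir j x * (radDeriv (angDeriv j f) x - angDeriv j f x))))
      + dir i x ^ 2 * (radDeriv (angDeriv j f) x - angDeriv j f x) ^ 2 := by
    intro i j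
    have := norm_mul_angDeriv_partialDeriv hf i j hx
    rw [← mul_pow, this, angDeriv_radDeriv j hf hx]
    split_ifs <;> ring
  have h2 : ∑ i, ∑ k, dir k x * (dir i x * sphHess f i k x) = 0 := by
    rw [Finset.sum_comm]
    simp only [← Finset.mul_sum, sum_dir_mul_sphHess hf _ hx, mul_zero, Finset.sum_const_zero]
  have h3 : ∑ i, ∑ j, (radDeriv (angDeriv j f) x - angDeriv j f x) *
      (dir i x * sphHess f i j x) = 0 := by
    rw [Finset.sum_comm]
    simp only [← Finset.mul_sum, sum_dir_mul_sphHess hf _ hx, mul_zero, Finset.sum_const_zero]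
  rw [mul_sub, mul_left_comm, sum_partialDeriv_sq f hx]
  simp only [Finset.mul_sum (s := Finset.univ (α := Fin N)) (a := ‖x‖ ^ 2), h]
  simp only [Finset.sum_add_distrib, Finset.sum_sub_distrib, ← Finset.mul_sum, h2, h3,
    Finset.sum_ite_eq, Finset.mem_univ, if_true, sum_sphHess_self hx, sum_dir_sq hx, ← sq,
    Finset.sum_const, Finset.card_univ, Fintype.card_fin, nsmul_eq_mul, mul_one,
    ← Finset.sum_mul, one_mul]
  have h4 : ∑ j, (radDeriv (angDeriv j f) x - angDeriv j f x) ^ 2 =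
      ∑ j, radDeriv (angDeriv j f) x ^ 2 -
        2 * ∑ j, radDeriv (angDeriv j f) x * angDeriv j f x + ∑ j, angDeriv j f x ^ 2 := by
    rw [Finset.mul_sum, ← Finset.sum_sub_distrib, ← Finset.sum_add_distrib]
    exact Finset.sum_congr rfl fun j _ => by ring
  rw [h4]
  ring

lemma RadialCutoff.wInt_radDeriv_mul_sphLap {w f : EuclideanSpace ℝ (Fin N) → ℝ}
    (hw : RadialCutoff w) (hf : SmoothOff f) :
    wInt w (fun x => radDeriv f x * sphLap f x) =
      -wInt w (fun x => ∑ j, radDeriv (angDeriv j f) x * angDeriv j f x) := by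
  have hA := hw.toAnnular
  have h : ∀ k, wInt w (angDeriv k (fun x => radDeriv f x * angDeriv k f x)) =
      ((N : ℝ) - 1) * wInt w (fun x => dir k x * (radDeriv f x * angDeriv k f x)) :=
    fun k => hw.wInt_angDeriv (by fun_prop) k
  have h2 := Finset.sum_congr (rfl : (Finset.univ : Finset (Fin N)) = _) fun k _ => h k
  rw [← hA.wInt_sum fun k _ => by fun_prop, ← Finset.mul_sum,
    ← hA.wInt_sum fun k _ => by fun_prop] at h2
  have h3 : wInt w (fun x => ∑ k, dir k x * (radDeriv f x * angDeriv k f x)) = 0 := by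
    rw [hA.wInt_congr (g := fun x => 0 * 0), wInt_const_mul, zero_mul]
    intro x hx
    simp only [mul_left_comm (dir _ x), ← Finset.mul_sum, sum_dir_mul_angDeriv f hx]
    ring
  rw [h3, mul_zero] at h2
  rw [eq_neg_iff_add_eq_zero, ← hA.wInt_add (by fun_prop) (by fun_prop), ← h2]
  refine hA.wInt_congr fun x hx => ?_
  simp only [sphLap, Finset.mul_sum, ← Finset.sum_add_distrib]
  refine Finset.sum_congr rfl fun k _ => ?_
  rw [fieldDeriv_mul (by fun_prop) (by fun_prop) hx, angDeriv_radDeriv k hf hx]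
  ring

lemma wInt_mul_weight (w g f : EuclideanSpace ℝ (Fin N) → ℝ) :
    wInt (fun x => w x * g x) f = wInt w (fun x => g x * f x) := by
  simp only [wInt, mul_assoc]

/-- Radial integration by parts for `2 g r∂_r g = r∂_r g²`. -/
lemma Annular.two_mul_wInt_mul_radDeriv {w g : EuclideanSpace ℝ (Fin N) → ℝ} (hw : Annular w)
    (hg : SmoothOff g) (e : ℝ) :
    2 * wInt w (fun x => ‖x‖ ^ e * (g x * radDeriv g x)) =
      -wInt (radDeriv w) (fun x => ‖x‖ ^ e * g x ^ 2)
        - (N + e) * wInt w (fun x => ‖x‖ ^ e * g x ^ 2) := by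
  have h := hw.wInt_radDeriv (f := fun x => ‖x‖ ^ e * (g x * g x)) (by fun_prop)
  have h2 : wInt w (radDeriv (fun x => ‖x‖ ^ e * (g x * g x))) =
      wInt w (fun x => e * (‖x‖ ^ e * g x ^ 2) + 2 * (‖x‖ ^ e * (g x * radDeriv g x))) := by
    refine hw.wInt_congr fun x hx => ?_
    rw [fieldDeriv_mul (by fun_prop) (by fun_prop) hx, radDeriv_norm_rpow e hx,
      fieldDeriv_mul (by fun_prop) (by fun_prop) hx]
    ring
  rw [hw.wInt_add (by fun_prop) (by fun_prop), wInt_const_mul, wInt_const_mul] at h2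
  simp only [← sq] at h
  simp only [← sq] at h2
  linarith

/-- The integrated spectral gap: for a gradient field the angular energy dominates `N - 1` times
the field, up to a boundary term. The spherical mean of a gradient field need not vanish, and the
condition on `a` compensates for it through radial derivatives. -/
lemma RadialCutoff.angular_hardy {w f : EuclideanSpace ℝ (Fin N) → ℝ} (hN : 1 ≤ N)
    (hw : RadialCutoff w) (h0 : ∀ x, 0 ≤ w x) (hf : SmoothOff f) {a : ℝ}
    (hab : (N : ℝ) + 1 ≤ ((N : ℝ) / 2 - a) ^ 2) :
    -(a - N / 2) * wInt (radDeriv w) (fun x => ‖x‖ ^ (-2 * a - 4) * ∑ j, angDeriv j f x ^ 2) ≤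
      wInt w (fun x => ‖x‖ ^ (-2 * a - 2) * (∑ i, ∑ j, angDeriv j (partialDeriv i f) x ^ 2 -
        ((N : ℝ) - 1) * ∑ i, partialDeriv i f x ^ 2)) := by
  set e := -2 * a - 4 with he
  have hA := hw.toAnnular
  have hv := hw.mul_norm_rpow e
  have hvA := hv.toAnnular
  have hv0 : ∀ x, 0 ≤ w x * ‖x‖ ^ e := fun x => mul_nonneg (h0 x) (by positivity)
  -- the optimal exponent of the radial Hardy inequality for the weight `‖x‖ ^ e`: `N + e = -2 ν`
  set ν := a + 2 - (N : ℝ) / 2 with hν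
  have h1 : wInt w (fun x => ‖x‖ ^ (-2 * a - 2) *
      (∑ i, ∑ j, angDeriv j (partialDeriv i f) x ^ 2 -
        ((N : ℝ) - 1) * ∑ i, partialDeriv i f x ^ 2)) =
      wInt (fun x => w x * ‖x‖ ^ e) (fun x => ∑ i, ∑ k, sphHess f i k x ^ 2
        + 2 * (radDeriv f x * sphLap f x)
        + ∑ j, ((radDeriv (angDeriv j f) x) ^ 2 - 2 * (radDeriv (angDeriv j f) x * angDeriv j f x)
        - ((N : ℝ) - 2) * angDeriv j f x ^ 2)) := by
    rw [wInt_mul_weight]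
    refine hA.wInt_congr fun x hx => ?_
    rw [← angular_energy_eq hf hx, ← mul_assoc, ← Real.rpow_add_natCast (norm_ne_zero_iff.2 hx)]
    congr 2
    rw [he]; push_cast; ring
  have h2 := hv.wInt_grad_le_hess hN hv0 hf
  have h3 := hv.wInt_radDeriv_mul_sphLap hf
  rw [hvA.wInt_add (by fun_prop) (by fun_prop), hvA.wInt_add (by fun_prop) (by fun_prop),
    wInt_const_mul, h3] at h1
  have h4 : wInt (fun x => w x * ‖x‖ ^ e) (fun x => (2 * ν - 4) *
        (∑ j, angDeriv j f x * radDeriv (angDeriv j f) x)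
        - (ν ^ 2 + N - 3) * (∑ j, angDeriv j f x ^ 2)) ≤
      wInt (fun x => w x * ‖x‖ ^ e) (fun x => ((∑ j, angDeriv j f x ^ 2) +
        2 * (-1 * ∑ j, radDeriv (angDeriv j f) x * angDeriv j f x)) +
        ∑ j, ((radDeriv (angDeriv j f) x) ^ 2 - 2 * (radDeriv (angDeriv j f) x * angDeriv j f x)
        - ((N : ℝ) - 2) * angDeriv j f x ^ 2)) := by
    refine hvA.wInt_mono hv0 (by fun_prop) (by fun_prop) fun x hx => ?_
    simp only [Finset.mul_sum]
    simp only [← Finset.sum_add_distrib, ← Finset.sum_sub_distrib]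
    refine Finset.sum_le_sum fun j _ => ?_
    -- `|r∂_r T|² ≥ 2 ν T r∂_r T - ν² T²` for the spherical gradient `T`
    nlinarith [sq_nonneg (radDeriv (angDeriv j f) x - ν * angDeriv j f x)]
  rw [hvA.wInt_sub (by fun_prop) (by fun_prop), hvA.wInt_add (by fun_prop) (by fun_prop),
    hvA.wInt_add (by fun_prop) (by fun_prop), wInt_const_mul, wInt_const_mul, wInt_const_mul,
    wInt_const_mul] at h4
  have h5 : 2 * wInt (fun x => w x * ‖x‖ ^ e)
        (fun x => ∑ j, angDeriv j f x * radDeriv (angDeriv j f) x) =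
      -wInt (radDeriv w) (fun x => ‖x‖ ^ e * ∑ j, angDeriv j f x ^ 2)
        - (N + e) * wInt (fun x => w x * ‖x‖ ^ e) (fun x => ∑ j, angDeriv j f x ^ 2) := by
    rw [wInt_mul_weight, wInt_mul_weight]
    simp only [Finset.mul_sum]
    rw [hA.wInt_sum fun i _ => by fun_prop, hA.wInt_sum fun i _ => by fun_prop,
      hA.rad.wInt_sum fun i _ => by fun_prop]
    simp only [Finset.mul_sum, ← Finset.sum_neg_distrib, ← Finset.sum_sub_distrib]
    exact Finset.sum_congr rfl fun j _ => hA.two_mul_wInt_mul_radDeriv (hf.ang j) e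
  have hT : 0 ≤ wInt (fun x => w x * ‖x‖ ^ e) (fun x => ∑ j, angDeriv j f x ^ 2) :=
    integral_nonneg fun x => mul_nonneg (hv0 x) (Finset.sum_nonneg fun j _ => sq_nonneg _)
  have hc : 0 ≤ (((N : ℝ) / 2 - a) ^ 2 - (N + 1)) *
      wInt (fun x => w x * ‖x‖ ^ e) (fun x => ∑ j, angDeriv j f x ^ 2) :=
    mul_nonneg (by linarith) hT
  rw [h1]
  have h6 : (N : ℝ) + e = -2 * ν := by rw [he, hν]; ring
  rw [h6] at h5
  have h7 : a = ν - 2 + (N : ℝ) / 2 := by rw [hν]; ring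
  rw [h7] at hc ⊢
  linear_combination h4 + h2 + hc - (ν - 2) * h5

end CKN

namespace CKN

variable {N : ℕ}

/-! ### The inequality with a cutoff -/

lemma sum_angDeriv_sq_le (f : EuclideanSpace ℝ (Fin N) → ℝ)
    {x : EuclideanSpace ℝ (Fin N)} (hx : x ≠ 0) :
    ∑ j, angDeriv j f x ^ 2 ≤ ‖x‖ ^ 2 * ∑ j, partialDeriv j f x ^ 2 := by
  rw [sum_partialDeriv_sq f hx]
  linarith [sq_nonneg (radDeriv f x)]

lemma rpow_mul_rpow_norm {x : EuclideanSpace ℝ (Fin N)} (hx : x ≠ 0) (p q : ℝ) :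
    ‖x‖ ^ p * ‖x‖ ^ q = ‖x‖ ^ (p + q) :=
  (Real.rpow_add (norm_pos_iff.2 hx) p q).symm

/-- Expanding `∫ w |r∂_r U - (m + σ) U + t r^s U|² r^(-2a-2) ≥ 0`. -/
lemma RadialCutoff.radial_square {w g : EuclideanSpace ℝ (Fin N) → ℝ}
    (hw : RadialCutoff w) (h0 : ∀ x, 0 ≤ w x) (hg : SmoothOff g) {a b σ : ℝ} (t : ℝ)
    (hσ : σ ^ 2 = (1 - (N : ℝ) / 2 + a) ^ 2 + N - 1) :
    t * (2 * σ + (a - b + 1)) * wInt w (fun x => ‖x‖ ^ (-(a + b + 1)) * g x ^ 2)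
        - (1 - (N : ℝ) / 2 + a + σ) * wInt (radDeriv w) (fun x => ‖x‖ ^ (-2 * a - 2) * g x ^ 2)
        + t * wInt (radDeriv w) (fun x => ‖x‖ ^ (-(a + b + 1)) * g x ^ 2) ≤
      wInt w (fun x => ‖x‖ ^ (-2 * a - 2) * radDeriv g x ^ 2)
        + ((N : ℝ) - 1) * wInt w (fun x => ‖x‖ ^ (-2 * a - 2) * g x ^ 2)
        + t ^ 2 * wInt w (fun x => ‖x‖ ^ (-(2 * b)) * g x ^ 2) := by
  have hA := hw.toAnnular
  set m := 1 - (N : ℝ) / 2 + a with hm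
  have h1 := hA.two_mul_wInt_mul_radDeriv hg (-2 * a - 2)
  have h2 := hA.two_mul_wInt_mul_radDeriv hg (-(a + b + 1))
  have h3 : 0 ≤ wInt w (fun x =>
      ‖x‖ ^ (-2 * a - 2) * radDeriv g x ^ 2
      + (m + σ) ^ 2 * (‖x‖ ^ (-2 * a - 2) * g x ^ 2)
      + t ^ 2 * (‖x‖ ^ (-(2 * b)) * g x ^ 2)
      - 2 * (m + σ) * (‖x‖ ^ (-2 * a - 2) * (g x * radDeriv g x))
      + 2 * t * (‖x‖ ^ (-(a + b + 1)) * (g x * radDeriv g x))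
      - 2 * t * (m + σ) * (‖x‖ ^ (-(a + b + 1)) * g x ^ 2)) := by
    have hz : wInt w (fun _ => 0) = 0 := by simp [wInt]
    rw [← hz]
    refine hA.wInt_mono h0 (by fun_prop) (by fun_prop) fun x hx => ?_
    have e1 : ‖x‖ ^ (-(a + b + 1)) = ‖x‖ ^ (-2 * a - 2) * ‖x‖ ^ (a - b + 1) := by
      rw [rpow_mul_rpow_norm hx]; congr 1; ring
    have e2 : ‖x‖ ^ (-(2 * b)) = ‖x‖ ^ (-2 * a - 2) * (‖x‖ ^ (a - b + 1) * ‖x‖ ^ (a - b + 1)) := by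
      rw [rpow_mul_rpow_norm hx, rpow_mul_rpow_norm hx]; congr 1; ring
    rw [e1, e2]
    have : 0 ≤ ‖x‖ ^ (-2 * a - 2) *
        (radDeriv g x - (m + σ) * g x + t * ‖x‖ ^ (a - b + 1) * g x) ^ 2 := by positivity
    linarith
  rw [hA.wInt_sub (by fun_prop) (by fun_prop), hA.wInt_add (by fun_prop) (by fun_prop),
    hA.wInt_sub (by fun_prop) (by fun_prop), hA.wInt_add (by fun_prop) (by fun_prop),
    hA.wInt_add (by fun_prop) (by fun_prop), wInt_const_mul, wInt_const_mul, wInt_const_mul,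
    wInt_const_mul, wInt_const_mul] at h3
  have hN : (N : ℝ) = 2 * (1 + a - m) := by rw [hm]; ring
  -- the equation for `σ` leaves the coefficient `N - 1` after the integration by parts
  have hσ' : (m + σ) ^ 2 = 2 * m * (m + σ) + (N - 1) := by linear_combination hσ
  rw [hσ'] at h3
  have e3 : (N : ℝ) + (-2 * a - 2) = -2 * m := by rw [hm]; ring
  have e4 : (N : ℝ) + (-(a + b + 1)) = -2 * m + (a - b + 1) := by rw [hm]; ring
  rw [e3] at h1
  rw [e4] at h2
  linear_combination h3 - (m + σ) * h1 + t * h2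

/-- The weighted inequality for one real potential. The last term, the integral against the
derivative of the cutoff, disappears when the cutoff exhausts the space. -/
lemma RadialCutoff.ckn_real {w f : EuclideanSpace ℝ (Fin N) → ℝ} (hN : 1 ≤ N)
    (hw : RadialCutoff w) (h0 : ∀ x, 0 ≤ w x) (hf : SmoothOff f) {a b σ : ℝ} (t : ℝ)
    (hab : (N : ℝ) + 1 ≤ ((N : ℝ) / 2 - a) ^ 2)
    (hσ : σ ^ 2 = (1 - (N : ℝ) / 2 + a) ^ 2 + N - 1) :
    t * (2 * σ + (a - b + 1)) *
        wInt w (fun x => ‖x‖ ^ (-(a + b + 1)) * ∑ i, partialDeriv i f x ^ 2) ≤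
      wInt w (fun x => ‖x‖ ^ (-(2 * a)) * ∑ i, ∑ j, partialDeriv j (partialDeriv i f) x ^ 2)
        + t ^ 2 * wInt w (fun x => ‖x‖ ^ (-(2 * b)) * ∑ i, partialDeriv i f x ^ 2)
        + (|a - N / 2| + |1 - (N : ℝ) / 2 + a + σ| + |t|) * ∫ x, |radDeriv w x| *
            ((‖x‖ ^ (-2 * a - 2) + ‖x‖ ^ (-(a + b + 1))) * ∑ i, partialDeriv i f x ^ 2) := by
  have hA := hw.toAnnular
  set m := 1 - (N : ℝ) / 2 + a with hm
  have h1 := hw.angular_hardy hN h0 hf hab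
  have h2 := Finset.sum_le_sum (s := Finset.univ) fun i _ =>
    hw.radial_square h0 (hf.pderiv i) (b := b) t hσ
  simp only [Finset.sum_add_distrib, Finset.sum_sub_distrib, ← Finset.mul_sum] at h2
  rw [← hA.wInt_sum fun i _ => by fun_prop, ← hA.wInt_sum fun i _ => by fun_prop,
    ← hA.wInt_sum fun i _ => by fun_prop, ← hA.wInt_sum fun i _ => by fun_prop,
    ← hA.rad.wInt_sum fun i _ => by fun_prop, ← hA.rad.wInt_sum fun i _ => by fun_prop] at h2
  simp only [← Finset.mul_sum] at h2
  have h3 : wInt w (fun x => ‖x‖ ^ (-(2 * a)) *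
        ∑ i, ∑ j, partialDeriv j (partialDeriv i f) x ^ 2) =
      wInt w (fun x => ‖x‖ ^ (-2 * a - 2) * (∑ i, ∑ j, angDeriv j (partialDeriv i f) x ^ 2 -
        ((N : ℝ) - 1) * ∑ i, partialDeriv i f x ^ 2)
        + ‖x‖ ^ (-2 * a - 2) * ∑ i, radDeriv (partialDeriv i f) x ^ 2
        + ((N : ℝ) - 1) * (‖x‖ ^ (-2 * a - 2) * ∑ i, partialDeriv i f x ^ 2)) := by
    refine hA.wInt_congr fun x hx => ?_
    have e1 : ‖x‖ ^ (-(2 * a)) = ‖x‖ ^ (-2 * a - 2) * ‖x‖ ^ 2 := by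
      rw [← Real.rpow_add_natCast (norm_ne_zero_iff.2 hx)]; congr 1; push_cast; ring
    rw [e1, mul_assoc, Finset.mul_sum]
    simp only [sum_partialDeriv_sq _ hx, Finset.sum_add_distrib]
    ring
  rw [hA.wInt_add (by fun_prop) (by fun_prop), hA.wInt_add (by fun_prop) (by fun_prop),
    wInt_const_mul] at h3
  -- the three boundary terms, collected into one integral
  set G : EuclideanSpace ℝ (Fin N) → ℝ := fun x =>
    (a - N / 2) * (‖x‖ ^ (-2 * a - 4) * ∑ j, angDeriv j f x ^ 2)
      + (m + σ) * (‖x‖ ^ (-2 * a - 2) * ∑ i, partialDeriv i f x ^ 2)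
      - t * (‖x‖ ^ (-(a + b + 1)) * ∑ i, partialDeriv i f x ^ 2) with hG
  have hGs : SmoothOff G := by rw [hG]; fun_prop
  have h4 : wInt (radDeriv w) G ≤
      (|a - N / 2| + |m + σ| + |t|) * ∫ x, |radDeriv w x| *
            ((‖x‖ ^ (-2 * a - 2) + ‖x‖ ^ (-(a + b + 1))) * ∑ i, partialDeriv i f x ^ 2) := by
    have hI : Integrable (fun x => |radDeriv w x| *
        ((‖x‖ ^ (-2 * a - 2) + ‖x‖ ^ (-(a + b + 1))) * ∑ i, partialDeriv i f x ^ 2)) := by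
      refine (hA.rad.mul (f := fun x => (‖x‖ ^ (-2 * a - 2) + ‖x‖ ^ (-(a + b + 1))) *
        ∑ i, partialDeriv i f x ^ 2) (by fun_prop)).integrable.abs.congr
        (Eventually.of_forall fun x => ?_)
      simp only [abs_mul (radDeriv w x)]
      rw [abs_of_nonneg (a := _ * _)]
      exact mul_nonneg (by positivity) (Finset.sum_nonneg fun i _ => sq_nonneg _)
    rw [← integral_const_mul]
    refine integral_mono (hA.rad.mul hGs).integrable (hI.const_mul _) fun x => ?_
    by_cases hx : x = 0
    · simp [hx, hA.rad.zero]
    have hS : 0 ≤ ∑ i, partialDeriv i f x ^ 2 := Finset.sum_nonneg fun i _ => sq_nonneg _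
    have hT : 0 ≤ ∑ i, angDeriv i f x ^ 2 := Finset.sum_nonneg fun i _ => sq_nonneg _
    set S := ∑ i, partialDeriv i f x ^ 2
    set p := ‖x‖ ^ (-2 * a - 2) with hp
    set q := ‖x‖ ^ (-(a + b + 1))
    have hp0 : 0 ≤ p := by positivity
    have hq0 : 0 ≤ q := by positivity
    have hTS : ‖x‖ ^ (-2 * a - 4) * ∑ i, angDeriv i f x ^ 2 ≤ p * S := by
      have e1 : p = ‖x‖ ^ (-2 * a - 4) * ‖x‖ ^ 2 := by
        rw [hp, ← Real.rpow_add_natCast (norm_ne_zero_iff.2 hx)]; congr 1; push_cast; ring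
      rw [e1, mul_assoc]
      exact mul_le_mul_of_nonneg_left (sum_angDeriv_sq_le f hx) (by positivity)
    have hGle : |G x| ≤ (|a - N / 2| + |m + σ| + |t|) * ((p + q) * S) := by
      have b1 : |(a - N / 2) * (‖x‖ ^ (-2 * a - 4) * ∑ j, angDeriv j f x ^ 2)| ≤
          |a - N / 2| * ((p + q) * S) := by
        rw [abs_mul, abs_of_nonneg (mul_nonneg (by positivity : 0 ≤ ‖x‖ ^ (-2 * a - 4)) hT)]
        exact mul_le_mul_of_nonneg_left (by nlinarith [mul_nonneg hq0 hS]) (abs_nonneg _)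
      have b2 : |(m + σ) * (p * S)| ≤ |m + σ| * ((p + q) * S) := by
        rw [abs_mul, abs_of_nonneg (mul_nonneg hp0 hS)]
        exact mul_le_mul_of_nonneg_left (by nlinarith [mul_nonneg hq0 hS]) (abs_nonneg _)
      have b3 : |t * (q * S)| ≤ |t| * ((p + q) * S) := by
        rw [abs_mul, abs_of_nonneg (mul_nonneg hq0 hS)]
        exact mul_le_mul_of_nonneg_left (by nlinarith [mul_nonneg hp0 hS]) (abs_nonneg _)
      calc |G x| ≤ |(a - N / 2) * (‖x‖ ^ (-2 * a - 4) * ∑ j, angDeriv j f x ^ 2)|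
            + |(m + σ) * (p * S)| + |t * (q * S)| :=
            (abs_sub _ _).trans (add_le_add_left (abs_add_le _ _) _)
        _ ≤ _ := by linarith
    calc radDeriv w x * G x ≤ |radDeriv w x| * |G x| := by rw [← abs_mul]; exact le_abs_self _
      _ ≤ |radDeriv w x| * ((|a - N / 2| + |m + σ| + |t|) * ((p + q) * S)) :=
          mul_le_mul_of_nonneg_left hGle (abs_nonneg _)
      _ = _ := by ring
  rw [hG, hA.rad.wInt_sub (by fun_prop) (by fun_prop),
    hA.rad.wInt_add (by fun_prop) (by fun_prop), wInt_const_mul, wInt_const_mul,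
    wInt_const_mul] at h4
  linear_combination h1 + h2 + h4 - h3

end CKN

namespace CKN

variable {N : ℕ}

/-! ### Exhausting cutoffs -/

/-- A smooth profile equal to `1` for `|r| ≤ 1` and to `0` for `r ^ 2 ≥ 2`. -/
noncomputable def cutProfile (r : ℝ) : ℝ := Real.smoothTransition (2 - r ^ 2)

/-- Radial cutoff that is `1` on a large annulus and vanishes near the origin and near infinity. -/
noncomputable def cutoff (R : ℝ) (x : EuclideanSpace ℝ (Fin N)) : ℝ :=
  cutProfile (R⁻¹ * ‖x‖) - cutProfile (R * ‖x‖)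

/-- The Euler derivative of the profile. -/
noncomputable def cutSlope (r : ℝ) : ℝ := r * deriv cutProfile r

lemma contDiff_cutProfile : ContDiff ℝ ∞ cutProfile :=
  (Real.smoothTransition.contDiff (n := ⊤)).comp (contDiff_const.sub (contDiff_id.pow 2))

lemma cutProfile_eq_one {r : ℝ} (h0 : 0 ≤ r) (h : r ≤ 1) : cutProfile r = 1 :=
  Real.smoothTransition.one_of_one_le (by nlinarith)

lemma cutProfile_eq_zero {r : ℝ} (h : 2 ≤ r) : cutProfile r = 0 :=
  Real.smoothTransition.zero_of_nonpos (by nlinarith)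

lemma contDiff_cutSlope : ContDiff ℝ ∞ cutSlope :=
  contDiff_id.mul ((contDiff_infty_iff_deriv.1 contDiff_cutProfile).2)

lemma cutSlope_ne_zero {r : ℝ} (h0 : 0 ≤ r) (h : cutSlope r ≠ 0) : 1 ≤ r ∧ r ≤ 2 := by
  constructor
  · by_contra! h1
    apply h
    rcases h0.eq_or_lt with rfl | h0
    · simp [cutSlope]
    have : cutProfile =ᶠ[𝓝 r] fun _ => 1 := by
      filter_upwards [Ioo_mem_nhds h0 h1] with y hy using cutProfile_eq_one hy.1.le hy.2.le
    simp [cutSlope, this.deriv_eq]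
  · by_contra! h1
    apply h
    have : cutProfile =ᶠ[𝓝 r] fun _ => 0 := by
      filter_upwards [Ioi_mem_nhds h1] with y hy using cutProfile_eq_zero (le_of_lt hy)
    simp [cutSlope, this.deriv_eq]

lemma SmoothOff.comp_norm {h : ℝ → ℝ} (hh : ContDiff ℝ ∞ h) :
    SmoothOff (fun x : EuclideanSpace ℝ (Fin N) => h ‖x‖) :=
  smoothOff_iff.2 fun _ hx => hh.contDiffAt.comp _ (contDiffAt_norm ℝ hx)

lemma fieldDeriv_comp_norm {V : EuclideanSpace ℝ (Fin N) → EuclideanSpace ℝ (Fin N)} {h : ℝ → ℝ}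
    {x : EuclideanSpace ℝ (Fin N)} (hx : x ≠ 0) (hh : DifferentiableAt ℝ h ‖x‖) :
    fieldDeriv V (fun y => h ‖y‖) x = deriv h ‖x‖ * fieldDeriv V (fun y => ‖y‖) x := by
  have h1 := (SmoothOff.norm.differentiableAt hx).hasFDerivAt
  have h2 : HasFDerivAt (fun y : EuclideanSpace ℝ (Fin N) => h ‖y‖) _ x :=
    hh.hasDerivAt.comp_hasFDerivAt x h1
  simp [fieldDeriv, h2.fderiv]

lemma cutoff_profile_contDiff (R : ℝ) :
    ContDiff ℝ ∞ (fun r => cutProfile (R⁻¹ * r) - cutProfile (R * r)) :=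
  (contDiff_cutProfile.comp (contDiff_const.mul contDiff_id)).sub
    (contDiff_cutProfile.comp (contDiff_const.mul contDiff_id))

lemma radialCutoff_cutoff {R : ℝ} (hR : 1 ≤ R) :
    RadialCutoff (cutoff R : EuclideanSpace ℝ (Fin N) → ℝ) where
  smooth := SmoothOff.comp_norm (cutoff_profile_contDiff R)
  supp := by
    have hR0 : 0 < R := by linarith
    refine ⟨R⁻¹, 2 * R, by positivity, fun x hx => ?_⟩
    have hn := norm_nonneg x
    constructor
    · by_contra! h
      apply hx
      have h1 : R * ‖x‖ ≤ 1 := by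
        rw [mul_comm, ← le_div_iff₀ hR0, one_div]; exact h.le
      have h2 : R⁻¹ * ‖x‖ ≤ 1 :=
        (mul_le_mul_of_nonneg_right ((inv_le_one_of_one_le₀ hR).trans hR) hn).trans h1
      rw [cutoff, cutProfile_eq_one (by positivity) h1, cutProfile_eq_one (by positivity) h2,
        sub_self]
    · by_contra! h
      apply hx
      have h2 : 2 ≤ R⁻¹ * ‖x‖ := by
        rw [mul_comm, ← div_eq_mul_inv, le_div_iff₀ hR0]; exact h.le
      have h1 : 2 ≤ R * ‖x‖ :=
        h2.trans (mul_le_mul_of_nonneg_right ((inv_le_one_of_one_le₀ hR).trans hR) hn)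
      rw [cutoff, cutProfile_eq_zero h1, cutProfile_eq_zero h2, sub_self]
  ang j x hx := by
    rw [show (cutoff R : EuclideanSpace ℝ (Fin N) → ℝ) = fun y =>
      (fun r => cutProfile (R⁻¹ * r) - cutProfile (R * r)) ‖y‖ from rfl,
      fieldDeriv_comp_norm hx ((cutoff_profile_contDiff R).differentiable (by simp) _),
      angDeriv_norm j hx, mul_zero]

lemma radDeriv_cutoff (R : ℝ) {x : EuclideanSpace ℝ (Fin N)} (hx : x ≠ 0) :
    radDeriv (cutoff R) x = cutSlope (R⁻¹ * ‖x‖) - cutSlope (R * ‖x‖) := by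
  have h : ∀ c r : ℝ, HasDerivAt (fun r => cutProfile (c * r)) (deriv cutProfile (c * r) * c) r := by
    intro c r
    have h1 : HasDerivAt (fun r : ℝ => c * r) c r := by simpa using (hasDerivAt_id r).const_mul c
    exact (contDiff_cutProfile.differentiable (by simp) (c * r)).hasDerivAt.comp r h1
  rw [show (cutoff R : EuclideanSpace ℝ (Fin N) → ℝ) = fun y =>
    (fun r => cutProfile (R⁻¹ * r) - cutProfile (R * r)) ‖y‖ from rfl,
    fieldDeriv_comp_norm hx ((cutoff_profile_contDiff R).differentiable (by simp) _),
    radDeriv_norm hx, ((h R⁻¹ ‖x‖).fun_sub (h R ‖x‖)).deriv]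
  simp only [cutSlope]
  ring

lemma cutoff_nonneg {R : ℝ} (hR : 1 ≤ R) (x : EuclideanSpace ℝ (Fin N)) : 0 ≤ cutoff R x := by
  have hR0 : 0 < R := by linarith
  have hn := norm_nonneg x
  refine sub_nonneg.2 (Real.smoothTransition.monotone (sub_le_sub_left ?_ _))
  exact pow_le_pow_left₀ (by positivity)
    (mul_le_mul_of_nonneg_right ((inv_le_one_of_one_le₀ hR).trans hR) hn) 2

lemma cutoff_le_one (R : ℝ) (x : EuclideanSpace ℝ (Fin N)) : cutoff R x ≤ 1 := by
  have h1 : cutProfile (R⁻¹ * ‖x‖) ≤ 1 := Real.smoothTransition.le_one _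
  have h2 : 0 ≤ cutProfile (R * ‖x‖) := Real.smoothTransition.nonneg _
  rw [cutoff]; linarith

lemma tendsto_cutoff {x : EuclideanSpace ℝ (Fin N)} (hx : x ≠ 0) :
    Tendsto (fun R => cutoff R x) atTop (𝓝 1) := by
  have hn := norm_pos_iff.2 hx
  refine tendsto_const_nhds.congr' ?_
  filter_upwards [eventually_ge_atTop ‖x‖, eventually_ge_atTop (2 / ‖x‖), eventually_gt_atTop 0]
    with R h1 h2 h3
  rw [cutoff, cutProfile_eq_one (by positivity), cutProfile_eq_zero, sub_zero]
  · rwa [div_le_iff₀ hn] at h2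
  · rw [mul_comm, ← div_eq_mul_inv, div_le_one h3]; exact h1

lemma ae_ne_zero (hN : 1 ≤ N) : ∀ᵐ x : EuclideanSpace ℝ (Fin N), x ≠ 0 := by
  have : Nonempty (Fin N) := ⟨⟨0, hN⟩⟩
  simp [ae_iff, measure_singleton]

lemma tendsto_integral_cutoff_mul (hN : 1 ≤ N) {F : EuclideanSpace ℝ (Fin N) → ℝ}
    (hF : Integrable F) :
    Tendsto (fun R => ∫ x, cutoff R x * F x) atTop (𝓝 (∫ x, F x)) := by
  refine tendsto_integral_filter_of_dominated_convergence (fun x => ‖F x‖) ?_ ?_ hF.norm ?_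
  · filter_upwards [eventually_ge_atTop 1] with R hR
    exact (radialCutoff_cutoff hR).contDiff.continuous.aestronglyMeasurable.mul
      hF.aestronglyMeasurable
  · filter_upwards [eventually_ge_atTop 1] with R hR
    refine Eventually.of_forall fun x => ?_
    rw [norm_mul, Real.norm_of_nonneg (cutoff_nonneg hR x)]
    exact mul_le_of_le_one_left (norm_nonneg _) (cutoff_le_one R x)
  · filter_upwards [ae_ne_zero hN] with x hx
    simpa using (tendsto_cutoff hx).mul_const (F x)

lemma annular_cutSlope {c : ℝ} (hc : 0 < c) : Annular (fun x : EuclideanSpace ℝ (Fin N) =>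
    cutSlope (c * ‖x‖) * ‖x‖ ^ (-(N : ℝ))) := by
  refine Annular.mul ⟨SmoothOff.comp_norm (h := fun r => cutSlope (c * r))
    (contDiff_cutSlope.comp (contDiff_const.mul contDiff_id)), c⁻¹, 2 / c, by positivity,
    fun x hx => ?_⟩ (SmoothOff.norm_rpow _)
  obtain ⟨h1, h2⟩ := cutSlope_ne_zero (by positivity) hx
  exact ⟨by rwa [inv_le_iff_one_le_mul₀' hc], by rwa [le_div_iff₀' hc]⟩

lemma integrable_abs_cutSlope {c : ℝ} (hc : 0 < c) :
    Integrable (fun x : EuclideanSpace ℝ (Fin N) => |cutSlope (c * ‖x‖)| * ‖x‖ ^ (-(N : ℝ))) := by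
  refine (annular_cutSlope hc).integrable.abs.congr (Eventually.of_forall fun x => ?_)
  simp only [abs_mul]
  rw [abs_of_nonneg (by positivity : 0 ≤ ‖x‖ ^ (-(N : ℝ)))]

/-- The measure `‖x‖ ^ (-N) dx` is invariant under dilations. -/
lemma integral_abs_cutSlope {c : ℝ} (hc : 0 < c) :
    ∫ x : EuclideanSpace ℝ (Fin N), |cutSlope (c * ‖x‖)| * ‖x‖ ^ (-(N : ℝ)) =
      ∫ x : EuclideanSpace ℝ (Fin N), |cutSlope ‖x‖| * ‖x‖ ^ (-(N : ℝ)) := by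
  have h := Measure.integral_comp_smul (volume : Measure (EuclideanSpace ℝ (Fin N)))
    (fun x => |cutSlope ‖x‖| * ‖x‖ ^ (-(N : ℝ))) c
  have hcN : 0 < c ^ N := by positivity
  simp only [norm_smul, Real.norm_of_nonneg hc.le, finrank_euclideanSpace, Fintype.card_fin,
    Real.mul_rpow hc.le (norm_nonneg _), smul_eq_mul, Real.rpow_neg hc.le, Real.rpow_natCast,
    abs_of_pos (inv_pos.2 hcN), mul_left_comm _ (c ^ N)⁻¹] at h
  rw [integral_const_mul] at h
  exact mul_left_cancel₀ (inv_pos.2 hcN).ne' h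

/-- The boundary terms vanish in the limit: the Euler derivative of the cutoff has bounded mass
for `‖x‖ ^ (-N) dx` and escapes to the origin and to infinity. -/
lemma tendsto_boundary {Φ : EuclideanSpace ℝ (Fin N) → ℝ} (hΦ : ∀ x, 0 ≤ Φ x)
    (hz : Tendsto Φ (𝓝[≠] 0) (𝓝 0)) (hi : Tendsto Φ (Bornology.cobounded _) (𝓝 0)) :
    Tendsto (fun R => ∫ x, |radDeriv (cutoff R) x| * (‖x‖ ^ (-(N : ℝ)) * Φ x)) atTop (𝓝 0) := by
  set K := ∫ x : EuclideanSpace ℝ (Fin N), |cutSlope ‖x‖| * ‖x‖ ^ (-(N : ℝ)) with hK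
  have hK0 : 0 ≤ K := integral_nonneg fun x => by positivity
  have hnn : ∀ R, 0 ≤ ∫ x : EuclideanSpace ℝ (Fin N),
      |radDeriv (cutoff R) x| * (‖x‖ ^ (-(N : ℝ)) * Φ x) := fun R =>
    integral_nonneg fun x => mul_nonneg (abs_nonneg _) (mul_nonneg (by positivity) (hΦ x))
  have key : ∀ ε > 0, ∀ᶠ R in atTop, ∫ x : EuclideanSpace ℝ (Fin N),
      |radDeriv (cutoff R) x| * (‖x‖ ^ (-(N : ℝ)) * Φ x) ≤ ε * (2 * K) := by
    intro ε hε
    have hz' := (hz.eventually (gt_mem_nhds hε))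
    rw [eventually_nhdsWithin_iff, Metric.eventually_nhds_iff] at hz'
    obtain ⟨δ, hδ, hz'⟩ := hz'
    have hi' := (hi.eventually (gt_mem_nhds hε))
    rw [← comap_norm_atTop, eventually_comap] at hi'
    obtain ⟨B, hi'⟩ := eventually_atTop.1 hi'
    filter_upwards [eventually_ge_atTop 1, eventually_ge_atTop B, eventually_gt_atTop (2 / δ)]
      with R h1 h2 h3
    have hR : 0 < R := by linarith
    have hI1 := integrable_abs_cutSlope (N := N) (inv_pos.2 hR)
    have hI2 := integrable_abs_cutSlope (N := N) hR
    have : ε * (2 * K) = ∫ x : EuclideanSpace ℝ (Fin N),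
        ε * (|cutSlope (R⁻¹ * ‖x‖)| * ‖x‖ ^ (-(N : ℝ)) +
          |cutSlope (R * ‖x‖)| * ‖x‖ ^ (-(N : ℝ))) := by
      rw [integral_const_mul, integral_add hI1 hI2, integral_abs_cutSlope (inv_pos.2 hR),
        integral_abs_cutSlope hR]
      ring
    rw [this]
    refine integral_mono_of_nonneg (Eventually.of_forall fun x =>
      mul_nonneg (abs_nonneg _) (mul_nonneg (by positivity) (hΦ x)))
      ((hI1.add hI2).const_mul ε) (Eventually.of_forall fun x => ?_)
    by_cases hx : x = 0
    · simp only [hx, (radialCutoff_cutoff h1).rad.zero, abs_zero, zero_mul]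
      positivity
    -- the outer slope lives where `R ≤ ‖x‖`, the inner one where `‖x‖ ≤ 2 / R`
    have b1 : |cutSlope (R⁻¹ * ‖x‖)| * Φ x ≤ |cutSlope (R⁻¹ * ‖x‖)| * ε := by
      by_cases hc : cutSlope (R⁻¹ * ‖x‖) = 0
      · simp [hc]
      · have h4 := (cutSlope_ne_zero (by positivity) hc).1
        refine mul_le_mul_of_nonneg_left (hi' ‖x‖ ?_ x rfl).le (abs_nonneg _)
        rw [← div_eq_inv_mul, le_div_iff₀ hR, one_mul] at h4
        exact h2.trans h4
    have b2 : |cutSlope (R * ‖x‖)| * Φ x ≤ |cutSlope (R * ‖x‖)| * ε := by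
      by_cases hc : cutSlope (R * ‖x‖) = 0
      · simp [hc]
      · have h4 := (cutSlope_ne_zero (by positivity) hc).2
        refine mul_le_mul_of_nonneg_left (hz' ?_ hx).le (abs_nonneg _)
        rw [div_lt_iff₀ hδ] at h3
        rw [dist_zero_right]
        exact lt_of_mul_lt_mul_left (h4.trans_lt h3) hR.le
    have hp : 0 ≤ ‖x‖ ^ (-(N : ℝ)) := by positivity
    simp only [radDeriv_cutoff R hx]
    calc |cutSlope (R⁻¹ * ‖x‖) - cutSlope (R * ‖x‖)| * (‖x‖ ^ (-(N : ℝ)) * Φ x)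
        ≤ (|cutSlope (R⁻¹ * ‖x‖)| + |cutSlope (R * ‖x‖)|) * (‖x‖ ^ (-(N : ℝ)) * Φ x) :=
          mul_le_mul_of_nonneg_right (abs_sub _ _) (mul_nonneg hp (hΦ x))
      _ = ‖x‖ ^ (-(N : ℝ)) *
          (|cutSlope (R⁻¹ * ‖x‖)| * Φ x + |cutSlope (R * ‖x‖)| * Φ x) := by ring
      _ ≤ ‖x‖ ^ (-(N : ℝ)) *
          (|cutSlope (R⁻¹ * ‖x‖)| * ε + |cutSlope (R * ‖x‖)| * ε) :=
          mul_le_mul_of_nonneg_left (add_le_add b1 b2) hp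
      _ = _ := by ring
  rw [Metric.tendsto_atTop']
  intro ε hε
  obtain ⟨B, hB⟩ := eventually_atTop.1 (key (ε / (2 * K + 1)) (by positivity))
  refine ⟨B, fun R hR => ?_⟩
  rw [Real.dist_eq, sub_zero, abs_of_nonneg (hnn R)]
  refine (hB R hR.le).trans_lt ?_
  rw [div_mul_eq_mul_div, div_lt_iff₀ (by positivity)]
  nlinarith

end CKN

namespace CKN

variable {𝕜 : Type*} [RCLike 𝕜] {N : ℕ}

/-! ### The inequality for real- and complex-valued potentials -/

lemma partialDeriv_clm_comp (L : 𝕜 →L[ℝ] ℝ) {u : EuclideanSpace ℝ (Fin N) → 𝕜} (i : Fin N)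
    {x : EuclideanSpace ℝ (Fin N)} (hu : DifferentiableAt ℝ u x) :
    partialDeriv i (fun y => L (u y)) x = L (partialDeriv i u x) := by
  have h : HasFDerivAt (fun y => L (u y)) _ x := L.hasFDerivAt.comp x hu.hasFDerivAt
  simp [partialDeriv, h.fderiv]

lemma partialDeriv_partialDeriv_clm_comp (L : 𝕜 →L[ℝ] ℝ) {u : EuclideanSpace ℝ (Fin N) → 𝕜}
    (hu : ContDiffOn ℝ ∞ u {0}ᶜ) (i j : Fin N) {x : EuclideanSpace ℝ (Fin N)} (hx : x ≠ 0) :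
    partialDeriv j (partialDeriv i (fun y => L (u y))) x =
      L (partialDeriv j (partialDeriv i u) x) := by
  have hat : ∀ {y : EuclideanSpace ℝ (Fin N)}, y ≠ 0 → ContDiffAt ℝ ∞ u y := fun hy =>
    hu.contDiffAt (isOpen_compl_singleton.mem_nhds hy)
  have h1 : partialDeriv i (fun y => L (u y)) =ᶠ[𝓝 x] fun y => L (partialDeriv i u y) := by
    filter_upwards [isOpen_compl_singleton.mem_nhds hx] with y hy
    exact partialDeriv_clm_comp L i ((hat hy).differentiableAt (by simp))
  have h2 : DifferentiableAt ℝ (partialDeriv i u) x :=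
    (((hat hx).fderiv_right (m := ∞) (by simp)).clm_apply contDiffAt_const).differentiableAt
      (by simp)
  rw [← partialDeriv_clm_comp L j h2]
  simp only [partialDeriv, h1.fderiv_eq]

lemma norm_sq_eq_re_sq_add_im_sq (z : 𝕜) :
    ‖z‖ ^ 2 = RCLike.reCLM z ^ 2 + RCLike.imCLM z ^ 2 := by
  rw [RCLike.norm_sq_eq_def]
  simp only [RCLike.reCLM_apply, RCLike.imCLM_apply]
  ring

lemma norm_sq_grad (u : EuclideanSpace ℝ (Fin N) → 𝕜) (x : EuclideanSpace ℝ (Fin N)) :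
    ‖grad u x‖ ^ 2 = ∑ i, ‖partialDeriv i u x‖ ^ 2 := by
  rw [EuclideanSpace.norm_sq_eq]; rfl

lemma norm_sq_grad_eq_re_add_im {u : EuclideanSpace ℝ (Fin N) → 𝕜} (hu : ContDiffOn ℝ ∞ u {0}ᶜ)
    {x : EuclideanSpace ℝ (Fin N)} (hx : x ≠ 0) :
    ‖grad u x‖ ^ 2 = ∑ i, partialDeriv i (fun y => RCLike.reCLM (u y)) x ^ 2 +
      ∑ i, partialDeriv i (fun y => RCLike.imCLM (u y)) x ^ 2 := by
  have hd : DifferentiableAt ℝ u x :=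
    (hu.contDiffAt (isOpen_compl_singleton.mem_nhds hx)).differentiableAt (by simp)
  simp only [norm_sq_grad, norm_sq_eq_re_sq_add_im_sq, Finset.sum_add_distrib,
    partialDeriv_clm_comp _ _ hd]

lemma hessianNormSq_eq_re_add_im {u : EuclideanSpace ℝ (Fin N) → 𝕜}
    (hu : ContDiffOn ℝ ∞ u {0}ᶜ) {x : EuclideanSpace ℝ (Fin N)} (hx : x ≠ 0) :
    hessianNormSq u x =
      ∑ i, ∑ j, partialDeriv j (partialDeriv i (fun y => RCLike.reCLM (u y))) x ^ 2 +
      ∑ i, ∑ j, partialDeriv j (partialDeriv i (fun y => RCLike.imCLM (u y))) x ^ 2 := by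
  simp only [hessianNormSq, norm_sq_eq_re_sq_add_im_sq, Finset.sum_add_distrib,
    partialDeriv_partialDeriv_clm_comp _ hu _ _ hx]

/-- A potential whose gradient is smooth off the origin is itself smooth there. -/
lemma contDiffOn_of_grad {u : EuclideanSpace ℝ (Fin N) → 𝕜} (hd : DifferentiableOn ℝ u {0}ᶜ)
    (hg : ContDiffOn ℝ ∞ (grad u) {0}ᶜ) : ContDiffOn ℝ ∞ u {0}ᶜ := by
  rw [contDiffOn_infty_iff_fderiv_of_isOpen isOpen_compl_singleton]
  refine ⟨hd, contDiffOn_clm_apply.2 fun v => ?_⟩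
  have h : ∀ x, fderiv ℝ u x v = ∑ j, v j • grad u x j := by
    intro x
    have hv : v = ∑ j, v j • EuclideanSpace.single j (1 : ℝ) := by
      ext i; simp [Pi.single_apply]
    have h2 : fderiv ℝ u x v = fderiv ℝ u x (∑ j, v j • EuclideanSpace.single j (1 : ℝ)) :=
      congrArg _ hv
    rw [h2, map_sum]
    exact Finset.sum_congr rfl fun j _ => by rw [map_smul]; rfl
  simp only [h]
  have hj : ∀ j, ContDiffOn ℝ ∞ (fun x => grad u x j) {0}ᶜ := fun j =>
    (PiLp.proj (𝕜 := ℝ) 2 (fun _ : Fin N => 𝕜) j).contDiff.comp_contDiffOn hg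
  exact ContDiffOn.sum fun j _ => (hj j).const_smul (v j)

lemma Annular.integrable_abs_mul {w f : EuclideanSpace ℝ (Fin N) → ℝ} (hw : Annular w)
    (hf : SmoothOff f) (h0 : ∀ x, 0 ≤ f x) : Integrable (fun x => |w x| * f x) := by
  refine (hw.mul hf).integrable.abs.congr (Eventually.of_forall fun x => ?_)
  simp only [abs_mul, abs_of_nonneg (h0 x)]

/-- The weighted inequality with a cutoff for `u`, summed over its real and imaginary part. -/
lemma RadialCutoff.ckn {w : EuclideanSpace ℝ (Fin N) → ℝ} (hN : 1 ≤ N)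
    (hw : RadialCutoff w) (h0 : ∀ x, 0 ≤ w x) {u : EuclideanSpace ℝ (Fin N) → 𝕜}
    (hu : ContDiffOn ℝ ∞ u {0}ᶜ) {a b σ : ℝ} (t : ℝ)
    (hab : (N : ℝ) + 1 ≤ ((N : ℝ) / 2 - a) ^ 2)
    (hσ : σ ^ 2 = (1 - (N : ℝ) / 2 + a) ^ 2 + N - 1) :
    t * (2 * σ + (a - b + 1)) * wInt w (fun x => ‖grad u x‖ ^ 2 / ‖x‖ ^ (a + b + 1)) ≤
      wInt w (fun x => hessianNormSq u x / ‖x‖ ^ (2 * a))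
        + t ^ 2 * wInt w (fun x => ‖grad u x‖ ^ 2 / ‖x‖ ^ (2 * b))
        + (|a - N / 2| + |1 - (N : ℝ) / 2 + a + σ| + |t|) * ∫ x, |radDeriv w x| *
            ((‖x‖ ^ (-2 * a - 2) + ‖x‖ ^ (-(a + b + 1))) * ‖grad u x‖ ^ 2) := by
  have hA := hw.toAnnular
  have hre : SmoothOff (fun y => RCLike.reCLM (u y)) :=
    (RCLike.reCLM (K := 𝕜)).contDiff.comp_contDiffOn hu
  have him : SmoothOff (fun y => RCLike.imCLM (u y)) :=
    (RCLike.imCLM (K := 𝕜)).contDiff.comp_contDiffOn hu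
  have hB : ∀ p : ℝ, wInt w (fun x => ‖grad u x‖ ^ 2 / ‖x‖ ^ p) =
      wInt w (fun x => ‖x‖ ^ (-p) * ∑ i, partialDeriv i (fun y => RCLike.reCLM (u y)) x ^ 2) +
      wInt w (fun x => ‖x‖ ^ (-p) * ∑ i, partialDeriv i (fun y => RCLike.imCLM (u y)) x ^ 2) := by
    intro p
    rw [← hA.wInt_add (by fun_prop) (by fun_prop)]
    refine hA.wInt_congr fun x hx => ?_
    rw [norm_sq_grad_eq_re_add_im hu hx, Real.rpow_neg (norm_nonneg x)]
    ring
  have hH : wInt w (fun x => hessianNormSq u x / ‖x‖ ^ (2 * a)) =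
      wInt w (fun x => ‖x‖ ^ (-(2 * a)) *
        ∑ i, ∑ j, partialDeriv j (partialDeriv i (fun y => RCLike.reCLM (u y))) x ^ 2) +
      wInt w (fun x => ‖x‖ ^ (-(2 * a)) *
        ∑ i, ∑ j, partialDeriv j (partialDeriv i (fun y => RCLike.imCLM (u y))) x ^ 2) := by
    rw [← hA.wInt_add (by fun_prop) (by fun_prop)]
    refine hA.wInt_congr fun x hx => ?_
    rw [hessianNormSq_eq_re_add_im hu hx, Real.rpow_neg (norm_nonneg x)]
    ring
  have hE : ∫ x, |radDeriv w x| *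
        ((‖x‖ ^ (-2 * a - 2) + ‖x‖ ^ (-(a + b + 1))) * ‖grad u x‖ ^ 2) =
      (∫ x, |radDeriv w x| * ((‖x‖ ^ (-2 * a - 2) + ‖x‖ ^ (-(a + b + 1))) *
        ∑ i, partialDeriv i (fun y => RCLike.reCLM (u y)) x ^ 2)) +
      ∫ x, |radDeriv w x| * ((‖x‖ ^ (-2 * a - 2) + ‖x‖ ^ (-(a + b + 1))) *
        ∑ i, partialDeriv i (fun y => RCLike.imCLM (u y)) x ^ 2) := by
    rw [← integral_add]
    · refine integral_congr_ae (Eventually.of_forall fun x => ?_)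
      by_cases hx : x = 0
      · simp [hx, hA.rad.zero]
      · simp only [norm_sq_grad_eq_re_add_im hu hx]
        ring
    · refine hA.rad.integrable_abs_mul (f := fun x =>
        (‖x‖ ^ (-2 * a - 2) + ‖x‖ ^ (-(a + b + 1))) *
        ∑ i, partialDeriv i (fun y => RCLike.reCLM (u y)) x ^ 2) (by fun_prop) fun x => ?_
      exact mul_nonneg (by positivity) (Finset.sum_nonneg fun i _ => sq_nonneg _)
    · refine hA.rad.integrable_abs_mul (f := fun x =>
        (‖x‖ ^ (-2 * a - 2) + ‖x‖ ^ (-(a + b + 1))) *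
        ∑ i, partialDeriv i (fun y => RCLike.imCLM (u y)) x ^ 2) (by fun_prop) fun x => ?_
      exact mul_nonneg (by positivity) (Finset.sum_nonneg fun i _ => sq_nonneg _)
  have h1 := hw.ckn_real hN h0 hre (b := b) t hab hσ
  have h2 := hw.ckn_real hN h0 him (b := b) t hab hσ
  rw [hB, hB, hH, hE]
  linear_combination h1 + h2

/-- The inequality `A + t² B ≥ t (2 σ + a - b + 1) D` between the three energies, for every real
`t`: the cutoff exhausts the space. -/
lemma IsAdmissible.quadratic {u : EuclideanSpace ℝ (Fin N) → 𝕜} (hN : 1 ≤ N) {a b σ : ℝ}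
    (hu : IsAdmissible a b u) (hab : (N : ℝ) + 1 ≤ ((N : ℝ) / 2 - a) ^ 2)
    (hσ : σ ^ 2 = (1 - (N : ℝ) / 2 + a) ^ 2 + N - 1) (t : ℝ) :
    t * (2 * σ + (a - b + 1)) * gradEnergy (a + b + 1) u ≤
      hessianEnergy (2 * a) u + t ^ 2 * gradEnergy (2 * b) u := by
  obtain ⟨hd, hX⟩ := hu
  have hs := contDiffOn_of_grad hd hX.smooth
  -- the decay conditions make the boundary density negligible with respect to `‖x‖ ^ (-N)`
  set Φ : EuclideanSpace ℝ (Fin N) → ℝ := fun x =>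
    (‖x‖ ^ (-1 + (N : ℝ) / 2 - a) * ‖grad u x‖) * (‖x‖ ^ (-1 + (N : ℝ) / 2 - a) * ‖grad u x‖) +
    (‖x‖ ^ (-1 + (N : ℝ) / 2 - a) * ‖grad u x‖) * (‖x‖ ^ (-b + (N : ℝ) / 2) * ‖grad u x‖) with hΦ
  have hz := (hX.tendsto_zero_a.mul hX.tendsto_zero_a).add
    (hX.tendsto_zero_a.mul hX.tendsto_zero_b)
  have hi := (hX.tendsto_infty_a.mul hX.tendsto_infty_a).add
    (hX.tendsto_infty_a.mul hX.tendsto_infty_b)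
  rw [mul_zero, add_zero] at hz hi
  have hE := tendsto_boundary (Φ := Φ) (fun x => by rw [hΦ]; positivity) hz hi
  have hA := tendsto_integral_cutoff_mul hN hX.integrable_jacobian
  have hB := tendsto_integral_cutoff_mul hN hX.integrable_field
  have hD := tendsto_integral_cutoff_mul hN hX.integrable_mixed
  have hR := (hA.add (hB.const_mul (t ^ 2))).add
    (hE.const_mul (|a - N / 2| + |1 - (N : ℝ) / 2 + a + σ| + |t|))
  rw [mul_zero, add_zero] at hR
  refine le_of_tendsto_of_tendsto (hD.const_mul (t * (2 * σ + (a - b + 1)))) hR ?_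
  filter_upwards [eventually_ge_atTop 1] with R h1
  have h := (radialCutoff_cutoff h1).ckn hN (cutoff_nonneg h1) hs (b := b) t hab hσ
  refine h.trans_eq ?_
  congr 2
  refine integral_congr_ae (Eventually.of_forall fun x => ?_)
  by_cases hx : x = 0
  · simp [hx, (radialCutoff_cutoff h1).rad.zero]
  simp only [hΦ]
  have e1 : ‖x‖ ^ (-2 * a - 2) = ‖x‖ ^ (-(N : ℝ)) *
      (‖x‖ ^ (-1 + (N : ℝ) / 2 - a) * ‖x‖ ^ (-1 + (N : ℝ) / 2 - a)) := by
    rw [rpow_mul_rpow_norm hx, rpow_mul_rpow_norm hx]; congr 1; ring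
  have e2 : ‖x‖ ^ (-(a + b + 1)) = ‖x‖ ^ (-(N : ℝ)) *
      (‖x‖ ^ (-1 + (N : ℝ) / 2 - a) * ‖x‖ ^ (-b + (N : ℝ) / 2)) := by
    rw [rpow_mul_rpow_norm hx, rpow_mul_rpow_norm hx]; congr 1; ring
  rw [e1, e2]
  ring

/-- The product inequality, obtained from the quadratic one by its discriminant. -/
theorem IsAdmissible.inequality {u : EuclideanSpace ℝ (Fin N) → 𝕜} (hN : 1 ≤ N) {a b σ : ℝ}
    (hu : IsAdmissible a b u) (hab : (N : ℝ) + 1 ≤ ((N : ℝ) / 2 - a) ^ 2)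
    (hσ : σ ^ 2 = (1 - (N : ℝ) / 2 + a) ^ 2 + N - 1) :
    (σ + (a - b + 1) / 2) ^ 2 * gradEnergy (a + b + 1) u ^ 2 ≤
      hessianEnergy (2 * a) u * gradEnergy (2 * b) u := by
  have h := discrim_le_zero (a := gradEnergy (2 * b) u)
    (b := -((2 * σ + (a - b + 1)) * gradEnergy (a + b + 1) u)) (c := hessianEnergy (2 * a) u)
    fun t => by linarith [hu.quadratic hN hab hσ t]
  rw [discrim] at h
  linarith

end CKN

namespace CKN

variable {𝕜 : Type*} [RCLike 𝕜] {N : ℕ}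

/-! ### Radial integrals of stretched exponentials -/

/-- The substitution `z = y ^ s`, for either sign of `s`, turns these integrals into Gamma
integrals. -/
lemma integrand_comp_rpow {q s c y : ℝ} (hs : s ≠ 0) (hy : 0 < y) :
    (|s| * y ^ (s - 1)) • ((y ^ s) ^ (q / s - 1) * Real.exp (-(c * y ^ s))) =
      |s| * (y ^ (q - 1) * Real.exp (-(c * y ^ s))) := by
  rw [← Real.rpow_mul hy.le, smul_eq_mul, mul_assoc, ← mul_assoc (y ^ (s - 1)),
    ← Real.rpow_add hy, show s - 1 + s * (q / s - 1) = q - 1 by field_simp; ring]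

lemma integrableOn_rpow_mul_exp {q s c : ℝ} (hs : s ≠ 0) (hq : 0 < q / s) (hc : 0 < c) :
    IntegrableOn (fun y : ℝ => y ^ (q - 1) * Real.exp (-(c * y ^ s))) (Set.Ioi 0) := by
  have h1 : IntegrableOn (fun z : ℝ => z ^ (q / s - 1) * Real.exp (-(c * z))) (Set.Ioi 0) := by
    have := integrableOn_rpow_mul_exp_neg_mul_rpow (p := 1) (s := q / s - 1) (b := c)
      (by linarith) one_pos hc
    simpa only [Real.rpow_one, neg_mul] using this
  rw [← integrableOn_Ioi_comp_rpow_iff _ hs] at h1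
  have h2 : IntegrableOn (fun y : ℝ => |s| * (y ^ (q - 1) * Real.exp (-(c * y ^ s))))
      (Set.Ioi 0) :=
    h1.congr_fun (fun y hy => integrand_comp_rpow hs hy) measurableSet_Ioi
  have h3 : |s| ≠ 0 := abs_ne_zero.2 hs
  refine (IntegrableOn.congr_fun (h2.const_mul |s|⁻¹) (fun y _ => ?_) measurableSet_Ioi)
  rw [inv_mul_cancel_left₀ h3]

lemma integral_rpow_mul_exp {q s c : ℝ} (hs : s ≠ 0) (hq : 0 < q / s) (hc : 0 < c) :
    |s| * ∫ y in Set.Ioi (0 : ℝ), y ^ (q - 1) * Real.exp (-(c * y ^ s)) =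
      (1 / c) ^ (q / s) * Real.Gamma (q / s) := by
  rw [← Real.integral_rpow_mul_exp_neg_mul_Ioi hq hc,
    ← integral_comp_rpow_Ioi (fun z => z ^ (q / s - 1) * Real.exp (-(c * z))) hs,
    ← integral_const_mul]
  exact setIntegral_congr_fun measurableSet_Ioi fun y hy => (integrand_comp_rpow hs hy).symm

/-- The integral of `‖x‖ ^ (q - N) exp (-c ‖x‖ ^ s)` over `ℝ^N`. -/
noncomputable def radialInt (N : ℕ) (c s q : ℝ) : ℝ :=
  ∫ x : EuclideanSpace ℝ (Fin N), ‖x‖ ^ (q - N) * Real.exp (-(c * ‖x‖ ^ s))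

lemma pow_mul_rpow_sub (hN : 1 ≤ N) (q : ℝ) {y : ℝ} (hy : 0 < y) :
    y ^ (N - 1) * y ^ (q - (N : ℝ)) = y ^ (q - 1) := by
  rw [← Real.rpow_natCast, ← Real.rpow_add hy, Nat.cast_sub hN]
  congr 1
  push_cast
  ring

lemma integrable_radial (hN : 1 ≤ N) {q s c : ℝ} (hs : s ≠ 0) (hq : 0 < q / s) (hc : 0 < c) :
    Integrable (fun x : EuclideanSpace ℝ (Fin N) =>
      ‖x‖ ^ (q - N) * Real.exp (-(c * ‖x‖ ^ s))) := by
  have : Nonempty (Fin N) := ⟨⟨0, hN⟩⟩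
  rw [integrable_fun_norm_addHaar (μ := (volume : Measure (EuclideanSpace ℝ (Fin N))))
    (f := fun y => y ^ (q - N) * Real.exp (-(c * y ^ s)))]
  refine (integrableOn_rpow_mul_exp hs hq hc).congr_fun (fun y hy => ?_) measurableSet_Ioi
  rw [finrank_euclideanSpace, Fintype.card_fin, smul_eq_mul, ← mul_assoc,
    pow_mul_rpow_sub hN q hy]

lemma radialInt_eq (hN : 1 ≤ N) (c s q : ℝ) :
    radialInt N c s q = N * volume.real (Metric.ball (0 : EuclideanSpace ℝ (Fin N)) 1) *
      ∫ y in Set.Ioi (0 : ℝ), y ^ (q - 1) * Real.exp (-(c * y ^ s)) := by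
  have : Nonempty (Fin N) := ⟨⟨0, hN⟩⟩
  rw [radialInt, integral_fun_norm_addHaar (volume : Measure (EuclideanSpace ℝ (Fin N)))
    (fun y => y ^ (q - N) * Real.exp (-(c * y ^ s)))]
  simp only [finrank_euclideanSpace, Fintype.card_fin, smul_eq_mul, nsmul_eq_mul]
  rw [mul_assoc]
  congr 2
  refine setIntegral_congr_fun measurableSet_Ioi fun y hy => ?_
  rw [← mul_assoc, pow_mul_rpow_sub hN q hy]

lemma radialInt_pos (hN : 1 ≤ N) {q s c : ℝ} (hs : s ≠ 0) (hq : 0 < q / s) (hc : 0 < c) :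
    0 < radialInt N c s q := by
  have h1 := integral_rpow_mul_exp hs hq hc
  have h2 : 0 < (1 / c) ^ (q / s) * Real.Gamma (q / s) :=
    mul_pos (by positivity) (Real.Gamma_pos_of_pos hq)
  rw [← h1] at h2
  have hb : 0 < volume.real (Metric.ball (0 : EuclideanSpace ℝ (Fin N)) 1) :=
    ENNReal.toReal_pos (Metric.measure_ball_pos _ _ one_pos).ne' measure_ball_lt_top.ne
  rw [radialInt_eq hN]
  have hN' : (0 : ℝ) < N := by exact_mod_cast hN
  exact mul_pos (mul_pos hN' hb) (pos_of_mul_pos_right h2 (abs_nonneg s))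

/-- The functional equation of the Gamma function. -/
lemma radialInt_add (hN : 1 ≤ N) {q s c : ℝ} (hs : s ≠ 0) (hq : 0 < q / s) (hc : 0 < c) :
    c * s * radialInt N c s (q + s) = q * radialInt N c s q := by
  have hq' : (q + s) / s = q / s + 1 := by field_simp
  have h1 := integral_rpow_mul_exp hs hq hc
  have h2 := integral_rpow_mul_exp (q := q + s) hs (by rw [hq']; linarith) hc
  rw [hq', Real.Gamma_add_one hq.ne', Real.rpow_add_one (by positivity)] at h2
  rw [radialInt_eq hN, radialInt_eq hN]
  have h3 : c * s * (∫ y in Set.Ioi (0 : ℝ), y ^ (q + s - 1) * Real.exp (-(c * y ^ s))) =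
      q * ∫ y in Set.Ioi (0 : ℝ), y ^ (q - 1) * Real.exp (-(c * y ^ s)) := by
    refine mul_left_cancel₀ (abs_ne_zero.2 hs) ?_
    calc _ = c * s * (|s| * ∫ y in Set.Ioi (0 : ℝ), y ^ (q + s - 1) *
          Real.exp (-(c * y ^ s))) := by ring
      _ = q * ((1 / c) ^ (q / s) * Real.Gamma (q / s)) := by
          rw [h2]; field_simp
      _ = _ := by rw [← h1]; ring
  linear_combination (N * volume.real (Metric.ball (0 : EuclideanSpace ℝ (Fin N)) 1)) * h3

lemma tendsto_rpow_mul_exp {k s c : ℝ} (hs : s ≠ 0) (hk : 0 < k / s) (hc : 0 < c) :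
    Tendsto (fun r : ℝ => r ^ k * Real.exp (-(c * r ^ s))) (𝓝[>] 0) (𝓝 0) ∧
      Tendsto (fun r : ℝ => r ^ k * Real.exp (-(c * r ^ s))) atTop (𝓝 0) := by
  have hf : ∀ r : ℝ, 0 < r → (r ^ s) ^ (k / s) * Real.exp (-c * r ^ s) =
      r ^ k * Real.exp (-(c * r ^ s)) := by
    intro r hr
    rw [← Real.rpow_mul hr.le, mul_div_cancel₀ _ hs, neg_mul]
  have htop : Tendsto (fun y : ℝ => y ^ (k / s) * Real.exp (-c * y)) atTop (𝓝 0) :=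
    tendsto_rpow_mul_exp_neg_mul_atTop_nhds_zero _ _ hc
  have hzero : Tendsto (fun y : ℝ => y ^ (k / s) * Real.exp (-c * y)) (𝓝 0) (𝓝 0) := by
    have h : ContinuousAt (fun y : ℝ => y ^ (k / s) * Real.exp (-c * y)) 0 :=
      (Real.continuousAt_rpow_const _ _ (Or.inr hk.le)).mul (by fun_prop)
    have h' := h.tendsto
    simpa [Real.zero_rpow hk.ne'] using h'
  have e1 : ∀ᶠ r : ℝ in 𝓝[>] 0, (r ^ s) ^ (k / s) * Real.exp (-c * r ^ s) =
      r ^ k * Real.exp (-(c * r ^ s)) := by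
    filter_upwards [self_mem_nhdsWithin] with r hr using hf r hr
  have e2 : ∀ᶠ r : ℝ in atTop, (r ^ s) ^ (k / s) * Real.exp (-c * r ^ s) =
      r ^ k * Real.exp (-(c * r ^ s)) := by
    filter_upwards [eventually_gt_atTop 0] with r hr using hf r hr
  rcases hs.lt_or_gt with hneg | hpos
  · refine ⟨(htop.comp (tendsto_rpow_neg_nhdsGT_zero hneg)).congr' e1,
      (hzero.comp ?_).congr' e2⟩
    simpa using tendsto_rpow_neg_atTop (neg_pos.2 hneg)
  · refine ⟨(hzero.comp ?_).congr' e1, (htop.comp (tendsto_rpow_atTop hpos)).congr' e2⟩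
    have h := (Real.continuousAt_rpow_const 0 s (Or.inr hpos.le)).tendsto
    rw [Real.zero_rpow hpos.ne'] at h
    exact h.mono_left nhdsWithin_le_nhds

/-! ### Extremal fields -/

/-- The radial profile `γ r^κ exp(-(β/s) r^s)` of the extremal fields. -/
noncomputable def profile (κ s γ β : ℝ) (r : ℝ) : ℝ :=
  γ * r ^ κ * Real.exp (-(β / s) * r ^ s)

lemma radialField_apply (κ s γ β : ℝ) (x : EuclideanSpace ℝ (Fin N)) (i : Fin N) :
    radialField 𝕜 κ s γ β x i = ((profile κ s γ β ‖x‖ * x i : ℝ) : 𝕜) := rfl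

lemma hasDerivAt_profile {κ s γ β r : ℝ} (hs : s ≠ 0) (hr : 0 < r) :
    HasDerivAt (profile κ s γ β) (profile κ s γ β r * ((κ - β * r ^ s) / r)) r := by
  have h1 : HasDerivAt (fun r : ℝ => r ^ κ) (κ * r ^ (κ - 1)) r :=
    Real.hasDerivAt_rpow_const (Or.inl hr.ne')
  have h2 : HasDerivAt (fun r : ℝ => r ^ s) (s * r ^ (s - 1)) r :=
    Real.hasDerivAt_rpow_const (Or.inl hr.ne')
  have h3 := (h1.const_mul γ).fun_mul (h2.const_mul (-(β / s))).exp
  refine h3.congr_deriv ?_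
  rw [Real.rpow_sub_one hr.ne', Real.rpow_sub_one hr.ne', profile]
  field_simp
  ring

lemma smoothOff_profile (κ s γ β : ℝ) :
    SmoothOff (fun x : EuclideanSpace ℝ (Fin N) => profile κ s γ β ‖x‖) := by
  have h : SmoothOff (fun x : EuclideanSpace ℝ (Fin N) => Real.exp (-(β / s) * ‖x‖ ^ s)) :=
    Real.contDiff_exp.comp_contDiffOn ((SmoothOff.const _).mul (SmoothOff.norm_rpow s))
  exact ((SmoothOff.const γ).mul (SmoothOff.norm_rpow κ)).mul h

lemma contDiffOn_radialField (κ s γ β : ℝ) :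
    ContDiffOn ℝ ∞ (radialField 𝕜 κ s γ β : EuclideanSpace ℝ (Fin N) → EuclideanSpace 𝕜 (Fin N))
      {0}ᶜ := by
  refine (contDiffOn_piLp (𝕜 := ℝ) 2).2 fun i => ?_
  exact (RCLike.ofRealCLM (K := 𝕜)).contDiff.comp_contDiffOn
    ((smoothOff_profile κ s γ β).mul (SmoothOff.coord i))

lemma norm_radialField (κ s γ β : ℝ) (x : EuclideanSpace ℝ (Fin N)) :
    ‖(radialField 𝕜 κ s γ β x : EuclideanSpace 𝕜 (Fin N))‖ = |profile κ s γ β ‖x‖| * ‖x‖ := by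
  have hx := EuclideanSpace.norm_eq x
  simp only [Real.norm_eq_abs] at hx
  rw [EuclideanSpace.norm_eq]
  simp only [radialField_apply, RCLike.norm_ofReal, abs_mul, mul_pow, ← Finset.mul_sum]
  rw [Real.sqrt_mul (sq_nonneg _), Real.sqrt_sq (abs_nonneg _), ← hx]

lemma partialDeriv_profile_mul {κ s γ β : ℝ} (hs : s ≠ 0) (i j : Fin N)
    {x : EuclideanSpace ℝ (Fin N)} (hx : x ≠ 0) :
    partialDeriv j (fun y => profile κ s γ β ‖y‖ * y i) x =
      profile κ s γ β ‖x‖ * ((if i = j then 1 else 0)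
        + (κ - β * ‖x‖ ^ s) * (dir i x * dir j x)) := by
  have hr := norm_pos_iff.2 hx
  have hd := hasDerivAt_profile (κ := κ) (γ := γ) (β := β) hs hr
  have h1 : partialDeriv j (fun y : EuclideanSpace ℝ (Fin N) => profile κ s γ β ‖y‖) x =
      profile κ s γ β ‖x‖ * ((κ - β * ‖x‖ ^ s) / ‖x‖) * dir j x := by
    have := fieldDeriv_comp_norm (V := fun _ => EuclideanSpace.single j 1) hx
      hd.differentiableAt
    rw [hd.deriv] at this
    rw [← partialDeriv_norm j hx]
    exact this
  rw [partialDeriv_mul (smoothOff_profile κ s γ β) (SmoothOff.coord i) j hx,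
    partialDeriv_coord, h1, ← norm_mul_dir i hx]
  field_simp
  ring

/-- The Jacobian of an extremal field has the radial eigenvalue `F (κ + 1 - β r^s)` and the
tangential eigenvalue `F` with multiplicity `N - 1`, where `F` is the profile. -/
lemma jacobianNormSq_of_eq_radialField {κ s γ β : ℝ} (hs : s ≠ 0)
    {U : EuclideanSpace ℝ (Fin N) → EuclideanSpace 𝕜 (Fin N)}
    (hU : ∀ x, x ≠ 0 → U x = radialField 𝕜 κ s γ β x)
    {x : EuclideanSpace ℝ (Fin N)} (hx : x ≠ 0) :
    jacobianNormSq U x = profile κ s γ β ‖x‖ ^ 2 *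
      ((N : ℝ) - 1 + (κ + 1 - β * ‖x‖ ^ s) ^ 2) := by
  have h : ∀ i j, ‖partialDeriv j (fun y => U y i) x‖ ^ 2 =
      profile κ s γ β ‖x‖ ^ 2 * ((if i = j then 1 else 0)
        + 2 * (κ - β * ‖x‖ ^ s) * (if i = j then dir i x * dir j x else 0)
        + (κ - β * ‖x‖ ^ s) ^ 2 * (dir i x ^ 2 * dir j x ^ 2)) := by
    intro i j
    have h1 : (fun y => U y i) =ᶠ[𝓝 x]
        fun y => RCLike.ofRealCLM (K := 𝕜) (profile κ s γ β ‖y‖ * y i) := by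
      filter_upwards [isOpen_compl_singleton.mem_nhds hx] with y hy
      rw [hU y hy, radialField_apply, RCLike.ofRealCLM_apply]
    have h2 : DifferentiableAt ℝ
        (fun y : EuclideanSpace ℝ (Fin N) => profile κ s γ β ‖y‖ * y i) x :=
      ((smoothOff_profile κ s γ β).mul (SmoothOff.coord i)).differentiableAt hx
    have h3 : HasFDerivAt (fun y : EuclideanSpace ℝ (Fin N) =>
        RCLike.ofRealCLM (K := 𝕜) (profile κ s γ β ‖y‖ * y i)) _ x :=
      (RCLike.ofRealCLM (K := 𝕜)).hasFDerivAt.comp x h2.hasFDerivAt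
    have h4 : partialDeriv j (fun y => U y i) x =
        ((partialDeriv j (fun y => profile κ s γ β ‖y‖ * y i) x : ℝ) : 𝕜) := by
      simp only [partialDeriv, h1.fderiv_eq, h3.fderiv]
      simp
    rw [h4, RCLike.norm_ofReal, sq_abs, partialDeriv_profile_mul hs i j hx]
    split_ifs <;> ring
  simp only [jacobianNormSq, h, ← Finset.mul_sum, Finset.sum_add_distrib, Finset.sum_ite_eq,
    Finset.mem_univ, if_true, sum_dir_sq hx, ← sq, Finset.sum_const, Finset.card_univ,
    Fintype.card_fin, nsmul_eq_mul, mul_one]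
  ring

lemma profile_sq {κ s γ β r : ℝ} (hr : 0 < r) :
    profile κ s γ β r ^ 2 = γ ^ 2 * (r ^ (2 * κ) * Real.exp (-(2 * (β / s) * r ^ s))) := by
  rw [profile, mul_pow, mul_pow, ← Real.rpow_mul_natCast hr.le, ← Real.exp_nat_mul]
  rw [mul_comm κ]
  push_cast
  rw [mul_assoc]
  congr 4
  ring

end CKN

namespace CKN

variable {𝕜 : Type*} [RCLike 𝕜] {N : ℕ}

lemma radialField_sq_div {κ s γ β p q : ℝ} (hq : 2 * κ + 2 - p = q - N)
    {x : EuclideanSpace ℝ (Fin N)} (hx : x ≠ 0) :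
    ‖(radialField 𝕜 κ s γ β x : EuclideanSpace 𝕜 (Fin N))‖ ^ 2 / ‖x‖ ^ p =
      γ ^ 2 * (‖x‖ ^ (q - N) * Real.exp (-(2 * (β / s) * ‖x‖ ^ s))) := by
  have hr := norm_pos_iff.2 hx
  rw [norm_radialField, mul_pow, sq_abs, profile_sq hr, ← hq, Real.rpow_sub hr,
    Real.rpow_add hr, Real.rpow_two]
  ring

lemma integrable_radialField {κ s γ β p q : ℝ} (hN : 1 ≤ N) (hs : s ≠ 0) (hβ : 0 < β / s)
    (hqs : 0 < q / s) (hq : 2 * κ + 2 - p = q - N)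
    {U : EuclideanSpace ℝ (Fin N) → EuclideanSpace 𝕜 (Fin N)}
    (hU : ∀ x, x ≠ 0 → U x = radialField 𝕜 κ s γ β x) :
    Integrable (fun x => ‖U x‖ ^ 2 / ‖x‖ ^ p) := by
  refine ((integrable_radial hN hs hqs (by positivity : 0 < 2 * (β / s))).const_mul
    (γ ^ 2)).congr ?_
  filter_upwards [ae_ne_zero hN] with x hx
  rw [hU x hx, radialField_sq_div hq hx]

lemma integral_radialField {κ s γ β p q : ℝ} (hN : 1 ≤ N) (hq : 2 * κ + 2 - p = q - N)
    {U : EuclideanSpace ℝ (Fin N) → EuclideanSpace 𝕜 (Fin N)}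
    (hU : ∀ x, x ≠ 0 → U x = radialField 𝕜 κ s γ β x) :
    ∫ x, ‖U x‖ ^ 2 / ‖x‖ ^ p = γ ^ 2 * radialInt N (2 * (β / s)) s q := by
  rw [radialInt, ← integral_const_mul]
  refine integral_congr_ae ?_
  filter_upwards [ae_ne_zero hN] with x hx
  rw [hU x hx, radialField_sq_div hq hx]

lemma jacobian_radialField_div {a κ s γ β q : ℝ} (hs : s ≠ 0) (hq : 2 * κ - 2 * a = q - N)
    {U : EuclideanSpace ℝ (Fin N) → EuclideanSpace 𝕜 (Fin N)}
    (hU : ∀ x, x ≠ 0 → U x = radialField 𝕜 κ s γ β x)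
    {x : EuclideanSpace ℝ (Fin N)} (hx : x ≠ 0) :
    jacobianNormSq U x / ‖x‖ ^ (2 * a) = γ ^ 2 *
      (((N : ℝ) - 1 + (κ + 1) ^ 2) *
          (‖x‖ ^ (q - N) * Real.exp (-(2 * (β / s) * ‖x‖ ^ s)))
        - 2 * (κ + 1) * β *
          (‖x‖ ^ (q + s - N) * Real.exp (-(2 * (β / s) * ‖x‖ ^ s)))
        + β ^ 2 * (‖x‖ ^ (q + s + s - N) * Real.exp (-(2 * (β / s) * ‖x‖ ^ s)))) := by
  have hr := norm_pos_iff.2 hx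
  have e1 : ‖x‖ ^ (q + s - N) = ‖x‖ ^ (q - N) * ‖x‖ ^ s := by
    rw [rpow_mul_rpow_norm hx]; congr 1; ring
  have e2 : ‖x‖ ^ (q + s + s - N) = ‖x‖ ^ (q - N) * (‖x‖ ^ s * ‖x‖ ^ s) := by
    rw [rpow_mul_rpow_norm hx, rpow_mul_rpow_norm hx]; congr 1; ring
  rw [jacobianNormSq_of_eq_radialField hs hU hx, profile_sq hr, e1, e2, ← hq, Real.rpow_sub hr]
  ring

lemma tendsto_norm_radialField {k κ s γ β j : ℝ} (hs : s ≠ 0) (hβ : 0 < β / s)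
    (hk : 0 < k / s) (hj : j + κ + 1 = k)
    {U : EuclideanSpace ℝ (Fin N) → EuclideanSpace 𝕜 (Fin N)}
    (hU : ∀ x, x ≠ 0 → U x = radialField 𝕜 κ s γ β x) :
    Tendsto (fun x => ‖x‖ ^ j * ‖U x‖) (𝓝[≠] 0) (𝓝 0) ∧
      Tendsto (fun x => ‖x‖ ^ j * ‖U x‖) (Bornology.cobounded (EuclideanSpace ℝ (Fin N)))
        (𝓝 0) := by
  obtain ⟨h1, h2⟩ := tendsto_rpow_mul_exp hs hk hβ
  have h1' := (h1.comp (tendsto_norm_nhdsNE_zero (E := EuclideanSpace ℝ (Fin N)))).const_mul |γ|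
  have h2' := (h2.comp (tendsto_norm_cobounded_atTop (E := EuclideanSpace ℝ (Fin N)))).const_mul |γ|
  rw [mul_zero] at h1' h2'
  have he : ∀ x : EuclideanSpace ℝ (Fin N), x ≠ 0 →
      |γ| * (‖x‖ ^ k * Real.exp (-(β / s * ‖x‖ ^ s))) = ‖x‖ ^ j * ‖U x‖ := by
    intro x hx
    have hr := norm_pos_iff.2 hx
    rw [hU x hx, norm_radialField, profile, abs_mul, abs_mul, abs_of_pos (Real.exp_pos _),
      abs_of_pos (Real.rpow_pos_of_pos hr κ), ← hj, Real.rpow_add_one hr.ne', Real.rpow_add hr,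
      neg_mul]
    ring
  refine ⟨h1'.congr' ?_, h2'.congr' ?_⟩
  · filter_upwards [self_mem_nhdsWithin] with x hx using he x hx
  · filter_upwards [(tendsto_norm_cobounded_atTop
      (E := EuclideanSpace ℝ (Fin N))).eventually_gt_atTop 0] with x hx
    exact he x (norm_pos_iff.1 hx)

lemma memX_of_eq_radialField (hN : 1 ≤ N) {a b σ γ β : ℝ} (hs : a - b + 1 ≠ 0)
    (hσ : 0 < σ / (a - b + 1)) (hβ : 0 < β / (a - b + 1))
    {U : EuclideanSpace ℝ (Fin N) → EuclideanSpace 𝕜 (Fin N)}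
    (hU : ∀ x, x ≠ 0 → U x = radialField 𝕜 (-(N : ℝ) / 2 + a + σ) (a - b + 1) γ β x) :
    MemX a b U := by
  have hc : 0 < 2 * (β / (a - b + 1)) := by positivity
  have q0 : 0 < 2 * σ / (a - b + 1) := by rw [mul_div_assoc]; positivity
  have q1 : 0 < (2 * σ + (a - b + 1)) / (a - b + 1) := by
    rw [add_div, div_self hs]; linarith
  have q2 : 0 < (2 * σ + (a - b + 1) + (a - b + 1)) / (a - b + 1) := by
    rw [add_div, div_self hs]; linarith
  have q3 : 0 < (σ + (a - b + 1)) / (a - b + 1) := by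
    rw [add_div, div_self hs]; linarith
  have ta := tendsto_norm_radialField (j := -1 + (N : ℝ) / 2 - a) hs hβ hσ (by ring) hU
  have tb := tendsto_norm_radialField (j := -b + (N : ℝ) / 2) hs hβ q3 (by ring) hU
  refine ⟨(contDiffOn_radialField _ _ γ β).congr hU, ?_,
    integrable_radialField hN hs hβ q2 (by ring) hU,
    integrable_radialField hN hs hβ q1 (by ring) hU, ta.1, ta.2, tb.1, tb.2⟩
  have i0 := integrable_radial hN hs q0 hc
  have i1 := integrable_radial hN hs q1 hc
  have i2 := integrable_radial hN hs q2 hc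
  refine ((((i0.const_mul ((N : ℝ) - 1 + ((-(N : ℝ) / 2 + a + σ) + 1) ^ 2)).sub
    (i1.const_mul (2 * ((-(N : ℝ) / 2 + a + σ) + 1) * β))).add (i2.const_mul (β ^ 2))).const_mul
      (γ ^ 2)).congr ?_
  filter_upwards [ae_ne_zero hN] with x hx
  exact (jacobian_radialField_div hs (q := 2 * σ) (by ring) hU hx).symm

/-- Both energies of an extremal field are multiples of the same Gamma integral, whence equality:
`A = β² B` and `(σ + s / 2) D = β B` for `s = a - b + 1`. -/
lemma equality_of_grad_eq_radialField (hN : 1 ≤ N) {a b σ γ β : ℝ} (hs : a - b + 1 ≠ 0)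
    (hσ : 0 < σ / (a - b + 1)) (hβ : 0 < β / (a - b + 1))
    (hσ2 : σ ^ 2 = (1 - (N : ℝ) / 2 + a) ^ 2 + N - 1)
    {u : EuclideanSpace ℝ (Fin N) → 𝕜}
    (hU : ∀ x, x ≠ 0 → grad u x = radialField 𝕜 (-(N : ℝ) / 2 + a + σ) (a - b + 1) γ β x) :
    hessianEnergy (2 * a) u * gradEnergy (2 * b) u =
      (σ + (a - b + 1) / 2) ^ 2 * gradEnergy (a + b + 1) u ^ 2 := by
  have hc : 0 < 2 * (β / (a - b + 1)) := by positivity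
  have q0 : 0 < 2 * σ / (a - b + 1) := by rw [mul_div_assoc]; positivity
  have q1 : 0 < (2 * σ + (a - b + 1)) / (a - b + 1) := by
    rw [add_div, div_self hs]; linarith
  have q2 : 0 < (2 * σ + (a - b + 1) + (a - b + 1)) / (a - b + 1) := by
    rw [add_div, div_self hs]; linarith
  have i0 := integrable_radial hN hs q0 hc
  have i1 := integrable_radial hN hs q1 hc
  have i2 := integrable_radial hN hs q2 hc
  have r0 := radialInt_add hN hs q0 hc
  have r1 := radialInt_add hN hs q1 hc
  have hD : gradEnergy (a + b + 1) u = _ :=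
    integral_radialField hN (q := 2 * σ + (a - b + 1)) (by ring) hU
  have hB : gradEnergy (2 * b) u = _ :=
    integral_radialField hN (q := 2 * σ + (a - b + 1) + (a - b + 1)) (by ring) hU
  set κ := -(N : ℝ) / 2 + a + σ with hκ
  set c := 2 * (β / (a - b + 1)) with hcdef
  have hA : hessianEnergy (2 * a) u = γ ^ 2 * (((N : ℝ) - 1 + (κ + 1) ^ 2) *
      radialInt N c (a - b + 1) (2 * σ)
      - 2 * (κ + 1) * β * radialInt N c (a - b + 1) (2 * σ + (a - b + 1))
      + β ^ 2 * radialInt N c (a - b + 1) (2 * σ + (a - b + 1) + (a - b + 1))) := by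
    rw [radialInt, radialInt, radialInt, ← integral_const_mul, ← integral_const_mul,
      ← integral_const_mul, ← integral_sub (i0.const_mul _) (i1.const_mul _),
      ← integral_add (by exact (i0.const_mul _).sub (i1.const_mul _)) (i2.const_mul _),
      ← integral_const_mul]
    refine integral_congr_ae ?_
    filter_upwards [ae_ne_zero hN] with x hx
    -- `hessianNormSq u` unfolds to `jacobianNormSq (grad u)`
    exact jacobian_radialField_div hs (q := 2 * σ) (by rw [hκ]; ring) hU hx
  have hcs : c * (a - b + 1) = 2 * β := by rw [hcdef]; field_simp
  rw [hcs] at r0 r1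
  -- the equation for `σ` in terms of the radial eigenvalue `κ + 1`
  have hp : (N : ℝ) - 1 + (κ + 1) ^ 2 = 2 * σ * (κ + 1) := by
    rw [hκ]; linear_combination -hσ2
  rw [hp] at hA
  have hAB : hessianEnergy (2 * a) u = β ^ 2 * gradEnergy (2 * b) u := by
    rw [hA, hB]
    linear_combination (-(γ ^ 2 * (κ + 1))) * r0
  have hDB : (σ + (a - b + 1) / 2) * gradEnergy (a + b + 1) u = β * gradEnergy (2 * b) u := by
    rw [hD, hB]
    linear_combination (-(γ ^ 2 / 2)) * r1
  rw [hAB, ← mul_pow, hDB]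
  ring

lemma gradEnergy_pos_of_eq_radialField (hN : 1 ≤ N) {a b σ γ β : ℝ} (hs : a - b + 1 ≠ 0)
    (hσ : 0 < σ / (a - b + 1)) (hβ : 0 < β / (a - b + 1)) (hγ : γ ≠ 0)
    {u : EuclideanSpace ℝ (Fin N) → 𝕜}
    (hU : ∀ x, x ≠ 0 → grad u x = radialField 𝕜 (-(N : ℝ) / 2 + a + σ) (a - b + 1) γ β x) :
    0 < gradEnergy (a + b + 1) u := by
  have hD : gradEnergy (a + b + 1) u = _ :=
    integral_radialField hN (q := 2 * σ + (a - b + 1)) (by ring) hU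
  rw [hD]
  refine mul_pos (by positivity) (radialInt_pos hN hs ?_ (by positivity))
  rw [mul_comm 2 σ, add_div, div_self hs, mul_div_right_comm]
  linarith

/-- A radial field is the gradient of the radial primitive `∫_1^‖x‖ F(t) t dt` of its profile. -/
lemma exists_grad_eq_radialField (𝕜 : Type*) [RCLike 𝕜] (N : ℕ) {κ s γ β : ℝ} (hs : s ≠ 0) :
    ∃ u : EuclideanSpace ℝ (Fin N) → 𝕜, DifferentiableOn ℝ u {0}ᶜ ∧
      ∀ x, x ≠ 0 → grad u x = radialField 𝕜 κ s γ β x := by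
  set g : ℝ → ℝ := fun t => profile κ s γ β t * t with hg
  have hcont : ContinuousOn g (Set.Ioi 0) := fun t ht =>
    ((hasDerivAt_profile hs ht).continuousAt.mul continuousAt_id).continuousWithinAt
  have hG : ∀ r : ℝ, 0 < r → HasDerivAt (fun r => ∫ t in (1 : ℝ)..r, g t) (g r) r := by
    intro r hr
    refine intervalIntegral.integral_hasDerivAt_right ?_ ?_
      (hcont.continuousAt (Ioi_mem_nhds hr))
    · refine (hcont.mono fun t ht => ?_).intervalIntegrable
      exact lt_of_lt_of_le (lt_min one_pos hr) ht.1
    · exact hcont.stronglyMeasurableAtFilter isOpen_Ioi r hr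
  have hV : ∀ x : EuclideanSpace ℝ (Fin N), x ≠ 0 → DifferentiableAt ℝ
      (fun y : EuclideanSpace ℝ (Fin N) => ∫ t in (1 : ℝ)..‖y‖, g t) x := fun x hx =>
    (hG _ (norm_pos_iff.2 hx)).differentiableAt.comp x (SmoothOff.norm.differentiableAt hx)
  have hu : ∀ x : EuclideanSpace ℝ (Fin N), x ≠ 0 → HasFDerivAt
      (fun y : EuclideanSpace ℝ (Fin N) =>
        RCLike.ofRealCLM (K := 𝕜) (∫ t in (1 : ℝ)..‖y‖, g t)) _ x := fun x hx =>
    (RCLike.ofRealCLM (K := 𝕜)).hasFDerivAt.comp x (hV x hx).hasFDerivAt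
  refine ⟨fun y => RCLike.ofRealCLM (K := 𝕜) (∫ t in (1 : ℝ)..‖y‖, g t),
    fun x hx => (hu x hx).differentiableAt.differentiableWithinAt, fun x hx => ?_⟩
  have hr := norm_pos_iff.2 hx
  ext i
  have h1 : partialDeriv i (fun y : EuclideanSpace ℝ (Fin N) => ∫ t in (1 : ℝ)..‖y‖, g t) x =
      profile κ s γ β ‖x‖ * x i := by
    have := fieldDeriv_comp_norm (V := fun _ => EuclideanSpace.single i 1) hx
      (hG _ hr).differentiableAt
    rw [(hG _ hr).deriv] at this
    rw [← norm_mul_dir i hx, ← partialDeriv_norm i hx, ← mul_assoc]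
    exact this
  rw [radialField_apply, ← h1]
  simp only [grad, partialDeriv, (hu x hx).fderiv]
  simp

/-- Inequality, sharpness and attainment at once, with a signed root `σ` that has the sign of
`a - b + 1`. -/
theorem sharp_inequality (𝕜 : Type*) [RCLike 𝕜] (hN : 1 ≤ N) {a b σ : ℝ}
    (hab : (N : ℝ) + 1 ≤ ((N : ℝ) / 2 - a) ^ 2) (hs : a - b + 1 ≠ 0)
    (hσ : 0 < σ / (a - b + 1)) (hσ2 : σ ^ 2 = (1 - (N : ℝ) / 2 + a) ^ 2 + N - 1) :
    (∀ u : EuclideanSpace ℝ (Fin N) → 𝕜, IsAdmissible a b u →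
        (σ + (a - b + 1) / 2) ^ 2 * gradEnergy (a + b + 1) u ^ 2 ≤
          hessianEnergy (2 * a) u * gradEnergy (2 * b) u) ∧
      (∀ K : ℝ,
        (∀ u : EuclideanSpace ℝ (Fin N) → 𝕜, IsAdmissible a b u →
          K * gradEnergy (a + b + 1) u ^ 2 ≤
            hessianEnergy (2 * a) u * gradEnergy (2 * b) u) →
        K ≤ (σ + (a - b + 1) / 2) ^ 2) ∧
      (∀ γ β : ℝ, 0 < β / (a - b + 1) →
        (∃ u : EuclideanSpace ℝ (Fin N) → 𝕜, DifferentiableOn ℝ u {0}ᶜ ∧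
          ∀ x, x ≠ 0 → grad u x =
            radialField 𝕜 (-(N : ℝ) / 2 + a + σ) (a - b + 1) γ β x) ∧
        (∀ u : EuclideanSpace ℝ (Fin N) → 𝕜, DifferentiableOn ℝ u {0}ᶜ →
          (∀ x, x ≠ 0 → grad u x =
            radialField 𝕜 (-(N : ℝ) / 2 + a + σ) (a - b + 1) γ β x) →
          IsAdmissible a b u ∧
          hessianEnergy (2 * a) u * gradEnergy (2 * b) u =
            (σ + (a - b + 1) / 2) ^ 2 * gradEnergy (a + b + 1) u ^ 2)) := by
  refine ⟨fun u hu => hu.inequality hN hab hσ2, fun K hK => ?_, fun γ β hβ =>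
    ⟨exists_grad_eq_radialField 𝕜 N hs, fun u hd hU =>
      ⟨⟨hd, memX_of_eq_radialField hN hs hσ hβ hU⟩,
        equality_of_grad_eq_radialField hN hs hσ hβ hσ2 hU⟩⟩⟩
  -- test the extremal with `γ = 1` and `β = a - b + 1`
  have hβ : 0 < (a - b + 1) / (a - b + 1) := by rw [div_self hs]; exact one_pos
  obtain ⟨u, hd, hU⟩ := exists_grad_eq_radialField 𝕜 N (κ := -(N : ℝ) / 2 + a + σ) (γ := 1)
    (β := a - b + 1) hs
  have h := hK u ⟨hd, memX_of_eq_radialField hN hs hσ hβ hU⟩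
  rw [equality_of_grad_eq_radialField hN hs hσ hβ hσ2 hU] at h
  have hpos := gradEnergy_pos_of_eq_radialField hN hs hσ hβ one_ne_zero hU
  exact le_of_mul_le_mul_right h (by positivity)

end CKN

theorem mainTheorem3 (𝕜 : Type*) [RCLike 𝕜] (N : ℕ) (hN : 1 ≤ N) (a b : ℝ)
    (hab : (N : ℝ) + 1 ≤ ((N : ℝ) / 2 - a) ^ 2) :
    (0 < a - b + 1 →
      (∀ u : EuclideanSpace ℝ (Fin N) → 𝕜, CKN.IsAdmissible a b u →
        (√((1 - (N : ℝ) / 2 + a) ^ 2 + N - 1) + (a - b + 1) / 2) ^ 2 *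
            CKN.gradEnergy (a + b + 1) u ^ 2 ≤
          CKN.hessianEnergy (2 * a) u * CKN.gradEnergy (2 * b) u) ∧
      (∀ K : ℝ,
        (∀ u : EuclideanSpace ℝ (Fin N) → 𝕜, CKN.IsAdmissible a b u →
          K * CKN.gradEnergy (a + b + 1) u ^ 2 ≤
            CKN.hessianEnergy (2 * a) u * CKN.gradEnergy (2 * b) u) →
        K ≤ (√((1 - (N : ℝ) / 2 + a) ^ 2 + N - 1) + (a - b + 1) / 2) ^ 2) ∧
      (∀ γ β : ℝ, 0 < β →
        (∃ u : EuclideanSpace ℝ (Fin N) → 𝕜, DifferentiableOn ℝ u {0}ᶜ ∧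
          ∀ x, x ≠ 0 → CKN.grad u x = CKN.radialField 𝕜
              (-(N : ℝ) / 2 + a + √((1 - (N : ℝ) / 2 + a) ^ 2 + N - 1)) (a - b + 1) γ β x) ∧
        (∀ u : EuclideanSpace ℝ (Fin N) → 𝕜, DifferentiableOn ℝ u {0}ᶜ →
          (∀ x, x ≠ 0 → CKN.grad u x = CKN.radialField 𝕜
              (-(N : ℝ) / 2 + a + √((1 - (N : ℝ) / 2 + a) ^ 2 + N - 1)) (a - b + 1) γ β x) →
          CKN.IsAdmissible a b u ∧
          CKN.hessianEnergy (2 * a) u * CKN.gradEnergy (2 * b) u =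
            (√((1 - (N : ℝ) / 2 + a) ^ 2 + N - 1) + (a - b + 1) / 2) ^ 2 *
              CKN.gradEnergy (a + b + 1) u ^ 2))) ∧
    (a - b + 1 < 0 →
      (∀ u : EuclideanSpace ℝ (Fin N) → 𝕜, CKN.IsAdmissible a b u →
        (√((1 - (N : ℝ) / 2 + a) ^ 2 + N - 1) - (a - b + 1) / 2) ^ 2 *
            CKN.gradEnergy (a + b + 1) u ^ 2 ≤
          CKN.hessianEnergy (2 * a) u * CKN.gradEnergy (2 * b) u) ∧
      (∀ K : ℝ,
        (∀ u : EuclideanSpace ℝ (Fin N) → 𝕜, CKN.IsAdmissible a b u →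
          K * CKN.gradEnergy (a + b + 1) u ^ 2 ≤
            CKN.hessianEnergy (2 * a) u * CKN.gradEnergy (2 * b) u) →
        K ≤ (√((1 - (N : ℝ) / 2 + a) ^ 2 + N - 1) - (a - b + 1) / 2) ^ 2) ∧
      (∀ γ β : ℝ, β < 0 →
        (∃ u : EuclideanSpace ℝ (Fin N) → 𝕜, DifferentiableOn ℝ u {0}ᶜ ∧
          ∀ x, x ≠ 0 → CKN.grad u x = CKN.radialField 𝕜
              (-(N : ℝ) / 2 + a - √((1 - (N : ℝ) / 2 + a) ^ 2 + N - 1)) (a - b + 1) γ β x) ∧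
        (∀ u : EuclideanSpace ℝ (Fin N) → 𝕜, DifferentiableOn ℝ u {0}ᶜ →
          (∀ x, x ≠ 0 → CKN.grad u x = CKN.radialField 𝕜
              (-(N : ℝ) / 2 + a - √((1 - (N : ℝ) / 2 + a) ^ 2 + N - 1)) (a - b + 1) γ β x) →
          CKN.IsAdmissible a b u ∧
          CKN.hessianEnergy (2 * a) u * CKN.gradEnergy (2 * b) u =
            (√((1 - (N : ℝ) / 2 + a) ^ 2 + N - 1) - (a - b + 1) / 2) ^ 2 *
              CKN.gradEnergy (a + b + 1) u ^ 2))) := by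
  set l := √((1 - (N : ℝ) / 2 + a) ^ 2 + N - 1) with hl
  have hN1 : (1 : ℝ) ≤ N := by exact_mod_cast hN
  -- the radicand vanishes only if `N = 1` and `a = -1 / 2`, which the hypothesis on `a` excludes
  have hpos : 0 < (1 - (N : ℝ) / 2 + a) ^ 2 + N - 1 := by
    have hm : 1 - (N : ℝ) / 2 + a ≠ 0 := by
      intro h0
      have h1 : (N : ℝ) / 2 - a = 1 := by linarith
      rw [h1] at hab
      linarith
    have := sq_pos_of_ne_zero hm
    linarith
  have hlpos : 0 < l := Real.sqrt_pos.2 hpos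
  have hl2 : l ^ 2 = (1 - (N : ℝ) / 2 + a) ^ 2 + N - 1 := Real.sq_sqrt hpos.le
  refine ⟨fun hs => ?_, fun hs => ?_⟩
  · obtain ⟨h1, h2, h3⟩ :=
      CKN.sharp_inequality 𝕜 hN hab hs.ne' (div_pos hlpos hs) hl2
    exact ⟨h1, h2, fun γ β hβ => h3 γ β (div_pos hβ hs)⟩
  · obtain ⟨h1, h2, h3⟩ :=
      CKN.sharp_inequality 𝕜 hN hab hs.ne
        (div_pos_of_neg_of_neg (neg_lt_zero.2 hlpos) hs) ((neg_sq l).trans hl2)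
    have hC : (l - (a - b + 1) / 2) ^ 2 = (-l + (a - b + 1) / 2) ^ 2 := by ring
    rw [hC, sub_eq_add_neg _ l]
    exact ⟨h1, h2, fun γ β hβ => h3 γ β (div_pos_of_neg_of_neg hβ hs)⟩
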